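/- **Proposition (Functoriality).** *Diagrams.* A diagram $(\mathcal B,w^\pm,\le_{r,s})$ consists of the following data. A bi-infinite Bratteli diagram $\mathcal B$: finite nonempty levels $\mathcal V_i$ ($i\in\mathbb Z$) of vertices and finitely many edges $e$ from $s(e)\in\mathcal V_i$ to $r(e)\in\mathcal V_{i+1}$ for each $i$, such that every vertex is the source of some edge and the range of some edge. Partial orders $\le_r,\le_s$ on the edges, for which two edges are comparable if and only if they have the same range, respectively the same source, and a total order on each level $\mathcal V_i$. A weight function $w^+$ for the positive half $\mathcal B^+$ (levels $\ge 0$) and a weight function $w^-$ for the negative half $\mathcal B^-$ (levels $\le 0$), with $\sum_{v\in\mathcal V_0}w^+(v)=1$ and $\sum_{v\in\mathcal V_0}w^+(v)w^-(v)=1$. The negative half is read as a diagram starting at $\mathcal V_0$ by reversing all edges, which exchanges $\le_r$ and $\le_s$. A weight function $w$ for a diagram with levels $V_0,V_1,\dots$ assigns positive numbers to the vertices of $V_0$ and to the edges such that (i) $w(v):=w(s(e_1))w(e_1)\cdots w(e_j)$ is the same for all paths $(e_1,\dots,e_j)$ from $V_0$ to $v$; (ii) $\sum_{s(e)=v}w(e)=1$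 for every $v$; (iii) $w(s(x_1))\prod_{i\le n}w(x_i)\to0$ for every infinite path $x$ from $V_0$ whose tail equivalence class is infinite. *Cutting and stacking maps.* Given an ordered diagram with levels $V_0,V_1,\dots$ and a weight function $w$, put open intervals of lengths $w(v)$, $v\in V_0$, side by side in the order of $V_0$, starting at $0$; these are the columns of stage $0$. Given the columns of stage $k$ over the vertices of $V_k$, cut every level of the column over $v$, from left to right, into open intervals of relative lengths $w(e)$, $s(e)=v$, in the order $\le_s$; the pieces for $e$ form a subcolumn. The column of stage $k+1$ over $v'$ is the stack of the subcolumns for the edges $e$ with $r(e)=v'$, from bottom to top in the order $\le_r$. The cutting and stacking map sends each point of a level which is not the top one in some column of some stage to the point directly above it. Moreover, for each finite tail equivalence class, the open interval of points whose position at every stage is given by the maximal path of the class (the interior of the intersection of the corresponding levels, possibly empty) is mapped by translation to the interval of the minimal path. The map is undefined elsewhere. *The surface $S(\mathcal B,w^\pm,\le_{r,s})$.* Let $T$ and $T'$ be the cutting and stacking maps of $(\mathcal B^+,w^+)$ and $(\mathcal B^-,w^-)$. For $\mathcal V_0=\{v_1<\dots<v_n\}$ let $$R_{v_i}=X_{v_i}\times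 Y_{v_i}=\Big[\sum_{j<i}w^+(v_j),\sum_{j\le i}w^+(v_j)\Big]\times\Big[\sum_{j<i}w^-(v_j),\sum_{j\le i}w^-(v_j)\Big].$$ The point of the top edge over $x$ is glued to the point of the bottom edge over $T(x)$, and the point of the right edge at height $y$ to the point of the left edge at height $T'(y)$; all corners and all boundary points that take part in no gluing are removed. $S(\mathcal B,w^\pm,\le_{r,s})$ is the quotient of the remaining subset of the plane by these identifications, with the quotient topology and the flat structure whose charts are the local coordinates that lift, near each point of the planar set, to translations of the plane. Two such surfaces given by planar sets with identifications are called equal if the planar sets and the identifications coincide. *The shift.* For $v\in\mathcal V_1$ let $w^+(v)$ be as in (i) and $w^-(v)=\sum_{r(e)=v}w^-(s(e))$, and let $t_1=-\log\sum_{v\in\mathcal V_1}w^+(v)$. The shift $\sigma(\mathcal B,w^\pm,\le_{r,s})$ is the diagram with levels $\mathcal V'_i=\mathcal V_{i+1}$, the same edges and orders, vertex weights $e^{\pm t_1}w^\pm(v)$ for $v\in\mathcal V'_0=\mathcal V_1$, the old weights on all edges that stay in the same half, and weight $w^-(s(e))/w^-(r(e))$ for the edges $e$ from $\mathcal V_0$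 to $\mathcal V_1$, which now belong to the negative half. *The renormalization map $\mathcal R$.* Deform $S(\mathcal B,w^\pm,\le_{r,s})$ by $g_{t_1}=\mathrm{diag}(e^{t_1},e^{-t_1})$. For each $v\in\mathcal V_0$, cut the deformed rectangle $g_{t_1}R_v$ by vertical lines, in the order $\le_s$, into sub-rectangles of widths $e^{t_1}w^+(v)w^+(e)$, one for each edge $e$ with $s(e)=v$. For each $v'\in\mathcal V_1$, stack the sub-rectangles of the edges $e$ with $r(e)=v'$ by translations to a tower, from bottom to top in the order $\le_r$, and arrange the towers diagonally in the order of $\mathcal V_1$, starting at the origin. Let $DS(\mathcal B,w^\pm,\le_{r,s})$ be the quotient of the union of the sub-rectangles in their new positions (without the removed points) by the equivalence relation generated by identifying the new positions of any points that represent the same point of $S(\mathcal B,w^\pm,\le_{r,s})$, with flat structure as above. *Claim.* For every diagram $(\mathcal B,w^\pm,\le_{r,s})$ there is a unique map $\mathcal R:S(\mathcal B,w^\pm,\le_{r,s})\to DS(\mathcal B,w^\pm,\le_{r,s})$ that sends the class of each point of each sub-rectangle to the class of its new position; $\mathcal R$ is an isomorphism of flat structures from $g_{t_1}S(\mathcal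 B,w^\pm,\le_{r,s})$ onto $DS(\mathcal B,w^\pm,\le_{r,s})$, i.e. a homeomorphism under which the charts correspond; and $$S(\sigma(\mathcal B,w^\pm,\le_{r,s}))=DS(\mathcal B,w^\pm,\le_{r,s})=\mathcal R\big(S(\mathcal B,w^\pm,\le_{r,s})\big).$$ -/

import Mathlib

open Filter Topology

namespace Bratteli

/-! ### Bi-infinite Bratteli diagrams and their orders -/

/-- A bi-infinite Bratteli diagram with vertex set `V` and edge set `E`.  The vertices of level `i`
are those with `lev v = i`, the edges between levels `i` and `i + 1` are those with
`lev (s e) = i`; every level is finite and nonempty, and every vertex is both a source and a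
range. -/
structure BiBratteli (V E : Type*) where
  lev : V → ℤ
  s : E → V
  r : E → V
  lev_r : ∀ e, lev (r e) = lev (s e) + 1
  finite_level : ∀ i, {v | lev v = i}.Finite
  nonempty_level : ∀ i, {v | lev v = i}.Nonempty
  finite_edges : ∀ i, {e | lev (s e) = i}.Finite
  exists_out : ∀ v, ∃ e, s e = v
  exists_in : ∀ v, ∃ e, r e = v

/-- A fully ordered bi-infinite Bratteli diagram: two edges are comparable for `leR` iff they have
the same range, and comparable for `leS` iff they have the same source.  The vertices of each level
carry a total order `leV`, used to arrange them from left to right. -/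
structure OrderedBratteli (V E : Type*) extends BiBratteli V E where
  leR : E → E → Prop
  leS : E → E → Prop
  leV : V → V → Prop
  leR_antisymm : ∀ e f, leR e f → leR f e → e = f
  leR_trans : ∀ e f g, leR e f → leR f g → leR e g
  leR_comparable : ∀ e f, (leR e f ∨ leR f e) ↔ r e = r f
  leS_antisymm : ∀ e f, leS e f → leS f e → e = f
  leS_trans : ∀ e f g, leS e f → leS f g → leS e g
  leS_comparable : ∀ e f, (leS e f ∨ leS f e) ↔ s e = s f
  leV_antisymm : ∀ u v, leV u v → leV v u → u = v
  leV_trans : ∀ u v w, leV u v → leV v w → leV u w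
  leV_comparable : ∀ u v, (leV u v ∨ leV v u) ↔ lev u = lev v

/-- A finite path that starts at a vertex, encoded by its first vertex and its list of edges. -/
inductive FinPath (V E : Type*)
  | start (v : V) : FinPath V E
  | snoc (p : FinPath V E) (e : E) : FinPath V E

/-- The data of a weight function: a number for each (level-`0`) vertex and each (positive) edge.
Only the values at vertices of level `0` and at edges of the positive half are ever used. -/
structure Weight (V E : Type*) where
  vert : V → ℝ
  edge : E → ℝ

variable {V E : Type*}

namespace BiBratteli

/-- `B.IsPath p v`: `p` is a positively oriented path from a vertex of level `0` to `v`. -/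
def IsPath (B : BiBratteli V E) : FinPath V E → V → Prop
  | .start u, v => u = v ∧ B.lev v = 0
  | .snoc p e, v => B.IsPath p (B.s e) ∧ B.r e = v

/-- The infinite paths of the positive half that start at level `0`. -/
def pathSpace (B : BiBratteli V E) : Set (ℕ → E) :=
  {x | B.lev (B.s (x 0)) = 0 ∧ ∀ n, B.r (x n) = B.s (x (n + 1))}

/-- The tail equivalence class of `x` in the path space of the positive half. -/
def tailClass (B : BiBratteli V E) (x : ℕ → E) : Set (ℕ → E) :=
  {y | y ∈ B.pathSpace ∧ ∃ N, ∀ k, N < k → x k = y k}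

/-- The path made of the first `n` edges of `x`. -/
def initial (B : BiBratteli V E) (x : ℕ → E) : ℕ → FinPath V E
  | 0 => .start (B.s (x 0))
  | n + 1 => .snoc (B.initial x n) (x n)

/-- The negative half read downwards: reversing all edges and all levels turns the negative half
of a bi-infinite diagram into the positive half of another one. -/
def rev (B : BiBratteli V E) : BiBratteli V E where
  lev v := -B.lev v
  s := B.r
  r := B.s
  lev_r e := by have := B.lev_r e; omega
  finite_level i := (B.finite_level (-i)).subset fun v (hv : -B.lev v = i) =>
    show B.lev v = -i by omega
  nonempty_level i := (B.nonempty_level (-i)).mono fun v (hv : B.lev v = -i) =>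
    show -B.lev v = i by omega
  finite_edges i := (B.finite_edges (-i - 1)).subset fun e (he : -B.lev (B.r e) = i) =>
    show B.lev (B.s e) = -i - 1 by have := B.lev_r e; omega
  exists_out := B.exists_in
  exists_in := B.exists_out

/-- The diagram with all indices shifted by one: the vertices of level `i + 1` become the vertices
of level `i`. -/
def shift (B : BiBratteli V E) : BiBratteli V E where
  lev v := B.lev v - 1
  s := B.s
  r := B.r
  lev_r e := by have := B.lev_r e; omega
  finite_level i := (B.finite_level (i + 1)).subset fun v (hv : B.lev v - 1 = i) =>
    show B.lev v = i + 1 by omega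
  nonempty_level i := (B.nonempty_level (i + 1)).mono fun v (hv : B.lev v = i + 1) =>
    show B.lev v - 1 = i by omega
  finite_edges i := (B.finite_edges (i + 1)).subset fun e (he : B.lev (B.s e) - 1 = i) =>
    show B.lev (B.s e) = i + 1 by omega
  exists_out := B.exists_out
  exists_in := B.exists_in

end BiBratteli

namespace OrderedBratteli

/-- Strict order on edges with the same range. -/
def ltR (B : OrderedBratteli V E) (e f : E) : Prop := B.leR e f ∧ e ≠ f

/-- Strict order on edges with the same source. -/
def ltS (B : OrderedBratteli V E) (e f : E) : Prop := B.leS e f ∧ e ≠ f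

/-- Strict order on vertices of the same level. -/
def ltV (B : OrderedBratteli V E) (u v : V) : Prop := B.leV u v ∧ u ≠ v

/-- The lexicographic order on finite paths induced by the order on edges with the same range: the
last edge at which the two paths differ decides. -/
def pathLt (B : OrderedBratteli V E) : FinPath V E → FinPath V E → Prop
  | .snoc p e, .snoc q f => B.ltR e f ∨ (e = f ∧ B.pathLt p q)
  | _, _ => False

/-- `q` is the immediate successor of `p` among the paths from level `0` to `v`. -/
def IsNext (B : OrderedBratteli V E) (v : V) (p q : FinPath V E) : Prop :=
  B.IsPath p v ∧ B.IsPath q v ∧ B.pathLt p q ∧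
    ∀ z, B.IsPath z v → ¬ (B.pathLt p z ∧ B.pathLt z q)

/-- `x` is a maximal path: each of its edges is maximal among the edges with the same range. -/
def IsMaxPath (B : OrderedBratteli V E) (x : ℕ → E) : Prop :=
  x ∈ B.pathSpace ∧ ∀ n f, B.r f = B.r (x n) → B.leR f (x n)

/-- `x` is a minimal path: each of its edges is minimal among the edges with the same range. -/
def IsMinPath (B : OrderedBratteli V E) (x : ℕ → E) : Prop :=
  x ∈ B.pathSpace ∧ ∀ n f, B.r f = B.r (x n) → B.leR (x n) f

/-- The reversed diagram; reversal exchanges the two orders on edges. -/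
def rev (B : OrderedBratteli V E) : OrderedBratteli V E where
  toBiBratteli := B.toBiBratteli.rev
  leR := B.leS
  leS := B.leR
  leV := B.leV
  leR_antisymm := B.leS_antisymm
  leR_trans := B.leS_trans
  leR_comparable := B.leS_comparable
  leS_antisymm := B.leR_antisymm
  leS_trans := B.leR_trans
  leS_comparable := B.leR_comparable
  leV_antisymm := B.leV_antisymm
  leV_trans := B.leV_trans
  leV_comparable u v := by
    rw [B.leV_comparable]; show _ ↔ -B.lev u = -B.lev v; omega

/-- The shifted diagram, with the same orders. -/
def shift (B : OrderedBratteli V E) : OrderedBratteli V E where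
  toBiBratteli := B.toBiBratteli.shift
  leR := B.leR
  leS := B.leS
  leV := B.leV
  leR_antisymm := B.leR_antisymm
  leR_trans := B.leR_trans
  leR_comparable := B.leR_comparable
  leS_antisymm := B.leS_antisymm
  leS_trans := B.leS_trans
  leS_comparable := B.leS_comparable
  leV_antisymm := B.leV_antisymm
  leV_trans := B.leV_trans
  leV_comparable u v := by
    rw [B.leV_comparable]; show _ ↔ B.lev u - 1 = B.lev v - 1; omega

end OrderedBratteli

/-! ### Weight functions -/

/-- The weight of a path: the weight of its first vertex times the weights of its edges. -/
def Weight.path (w : Weight V E) : FinPath V E → ℝ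
  | .start v => w.vert v
  | .snoc p e => w.path p * w.edge e

/-- The weight `w(v)` of a vertex of level `≥ 0`: the weight of any path from level `0` to `v`. -/
noncomputable def Weight.vertex (w : Weight V E) (B : BiBratteli V E) (v : V) : ℝ :=
  open Classical in if h : ∃ p, B.IsPath p v then w.path h.choose else 0

/-- `w` is a weight function for the positive half of `B`. -/
structure IsWeightFunction (B : BiBratteli V E) (w : Weight V E) : Prop where
  vert_pos : ∀ v, B.lev v = 0 → 0 < w.vert v
  edge_pos : ∀ e, 0 ≤ B.lev (B.s e) → 0 < w.edge e
  path_eq : ∀ v p q, B.IsPath p v → B.IsPath q v → w.path p = w.path q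
  sum_out : ∀ v, 0 ≤ B.lev v → ∑ᶠ e ∈ {e | B.s e = v}, w.edge e = 1
  tendsto_zero : ∀ x ∈ B.pathSpace, (B.tailClass x).Infinite →
    Tendsto (fun n => w.path (B.initial x n)) atTop (𝓝 0)

/-- A diagram: a bi-infinite, fully ordered Bratteli diagram with a weight function `wp` on the
positive half and a weight function `wm` on the negative half, normalized so that the weights `wp`
of level `0` sum to `1` and the total area is `1`. -/
structure Diagram (V E : Type*) extends OrderedBratteli V E where
  wp : Weight V E
  wm : Weight V E
  wp_isWeight : IsWeightFunction toBiBratteli wp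
  wm_isWeight : IsWeightFunction toBiBratteli.rev wm
  wp_sum : ∑ᶠ v ∈ {v | lev v = 0}, wp.vert v = 1
  area : ∑ᶠ v ∈ {v | lev v = 0}, wp.vert v * wm.vert v = 1

/-! ### The cutting and stacking map of an ordered weighted diagram -/

namespace OrderedBratteli

/-- The left endpoint of the level of a column that corresponds to a path.  At stage `0` the
intervals over the vertices of level `0` are put side by side in the order of the vertices; at each
later stage the levels of the column over a vertex `u` are cut, from left to right in the order of
the edges `e` with source `u`, into pieces of relative length `w(e)`. -/
noncomputable def left (B : OrderedBratteli V E) (w : Weight V E) : FinPath V E → ℝ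
  | .start v => ∑ᶠ u ∈ {u | B.ltV u v}, w.vert u
  | .snoc p e => B.left w p + w.path p * ∑ᶠ f ∈ {f | B.ltS f e}, w.edge f

/-- The (open) level of a column that corresponds to a path; its length is the weight of the
path. -/
noncomputable def level (B : OrderedBratteli V E) (w : Weight V E) (p : FinPath V E) : Set ℝ :=
  Set.Ioo (B.left w p) (B.left w p + w.path p)

/-- The graph of the cutting and stacking map `T`.  A point of a level of the column over `v` which
is not the top level is sent to the point of the next level directly above it.  On a periodic
component, the interval of the maximal path is sent by a translation to the interval of the minimal
path (these intervals are empty unless the component has positive measure). -/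
inductive CutStackMap (B : OrderedBratteli V E) (w : Weight V E) : ℝ → ℝ → Prop
  | up (v : V) (p q : FinPath V E) (a : ℝ) (hpq : B.IsNext v p q) (ha : a ∈ B.level w p) :
      CutStackMap B w a (a - B.left w p + B.left w q)
  | periodic (x y : ℕ → E) (a b : ℝ) (hx : B.IsMaxPath x) (hy : B.IsMinPath y)
      (hxy : y ∈ B.tailClass x) (hfin : (B.tailClass x).Finite)
      (ha : a ∈ interior (⋂ n, B.level w (B.initial x n)))
      (hb : ∀ᶠ n in atTop, b = a - B.left w (B.initial x n) + B.left w (B.initial y n)) :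
      CutStackMap B w a b

end OrderedBratteli

/-! ### Flat surfaces obtained by gluing planar regions -/

/-- A topological space with a flat structure: a set of charts in the plane, all of whose transition
maps are locally translations. -/
structure FlatStructure where
  carrier : Type
  [top : TopologicalSpace carrier]
  charts : Set (OpenPartialHomeomorph carrier (ℝ × ℝ))
  translation : ∀ φ ∈ charts, ∀ ψ ∈ charts, ∀ p ∈ φ.source ∩ ψ.source,
    ∃ c : ℝ × ℝ, ∀ᶠ q in 𝓝 p, ψ q = φ q + c

attribute [instance] FlatStructure.top

/-- The linear map `(x, y) ↦ (exp t * x, exp (-t) * y)` of the plane. -/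
noncomputable def diagMap (t : ℝ) : (ℝ × ℝ) ≃ₜ (ℝ × ℝ) :=
  (Homeomorph.mulLeft₀ (Real.exp t) (Real.exp_ne_zero _)).prodCongr
    (Homeomorph.mulLeft₀ (Real.exp (-t)) (Real.exp_ne_zero _))

theorem diagMap_apply (t : ℝ) (p : ℝ × ℝ) :
    diagMap t p = (Real.exp t * p.1, Real.exp (-t) * p.2) := rfl

/-- The Teichmüller deformation for time `t`: all charts are composed with `diagMap t`. -/
noncomputable def FlatStructure.teich (t : ℝ) (S : FlatStructure) : FlatStructure where
  carrier := S.carrier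
  charts := {ψ | ∃ φ ∈ S.charts, ψ = φ.transHomeomorph (diagMap t)}
  translation := by
    rintro _ ⟨φ, hφ, rfl⟩ _ ⟨ψ, hψ, rfl⟩ p hp
    obtain ⟨c, hc⟩ := S.translation φ hφ ψ hψ p hp
    refine ⟨diagMap t c, ?_⟩
    filter_upwards [hc] with q hq
    simp only [OpenPartialHomeomorph.transHomeomorph_apply, Function.comp_apply, hq,
      diagMap_apply]
    ext <;> simp [mul_add]

/-- `f` is an isomorphism of flat structures: a homeomorphism under which the charts
correspond to each other. -/
def FlatStructure.IsIso (S S' : FlatStructure) (f : S.carrier → S'.carrier) : Prop :=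
  ∃ h : S.carrier ≃ₜ S'.carrier, (∀ p, h p = f p) ∧
    ∀ φ : OpenPartialHomeomorph S'.carrier (ℝ × ℝ),
      φ ∈ S'.charts ↔ h.transOpenPartialHomeomorph φ ∈ S.charts

/-- Gluing data: a region of the plane and an equivalence relation of the plane, which is used on
the region only. -/
structure PlanarGluing where
  region : Set (ℝ × ℝ)
  rel : Setoid (ℝ × ℝ)

namespace PlanarGluing

/-- The points of the region up to the identifications, with the quotient topology. -/
def Space (G : PlanarGluing) : Type :=
  Quotient (G.rel.comap (Subtype.val : G.region → ℝ × ℝ))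

instance (G : PlanarGluing) : TopologicalSpace G.Space :=
  inferInstanceAs (TopologicalSpace (Quotient _))

/-- The class of a point of the region. -/
def proj (G : PlanarGluing) (p : G.region) : G.Space := Quotient.mk _ p

/-- The surface of gluing data, with its flat structure.  Its charts are the coordinates which, at every point of the
region lying over their domain, agree locally in the region with a translation of the plane. -/
def surface (G : PlanarGluing) : FlatStructure where
  carrier := G.Space
  charts := {φ | ∀ p : G.region, G.proj p ∈ φ.source →
    ∃ c : ℝ × ℝ, ∀ᶠ q in 𝓝 p, φ (G.proj q) = (q : ℝ × ℝ) + c}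
  translation := by
    intro φ hφ ψ hψ p hp
    refine ⟨ψ p - φ p, ?_⟩
    have hq : IsQuotientMap G.proj := isQuotientMap_quotient_mk'
    set U : Set G.Space := {q | q ∈ φ.source ∩ ψ.source ∧ ψ q = φ q + (ψ p - φ p)} with hU
    have hUo : IsOpen U := by
      rw [← hq.isOpen_preimage, isOpen_iff_mem_nhds]
      rintro x ⟨hx, hx'⟩
      obtain ⟨c, hc⟩ := hφ x hx.1
      obtain ⟨d, hd⟩ := hψ x hx.2
      have hs : ∀ᶠ y in 𝓝 x, G.proj y ∈ φ.source ∩ ψ.source :=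
        hq.continuous.continuousAt.eventually
          ((φ.open_source.inter ψ.open_source).mem_nhds hx)
      have h1 := hc.self_of_nhds
      have h2 := hd.self_of_nhds
      have h3 : d = c + (ψ p - φ p) := by
        have : (x : ℝ × ℝ) + d = x + (c + (ψ p - φ p)) := by
          rw [← h2, hx', h1, add_assoc]
        exact add_left_cancel this
      filter_upwards [hc, hd, hs] with y hy1 hy2 hy3
      refine ⟨hy3, ?_⟩
      rw [hy1, hy2, h3, add_assoc]
    have hpU : p ∈ U := ⟨hp, by abel⟩
    filter_upwards [hUo.mem_nhds hpU] with q hq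
    exact hq.2

end PlanarGluing

/-! ### The surface of a diagram -/

namespace Diagram

/-- Left endpoint of the horizontal side `X_v` of the rectangle of `v`, for `v` of level `0`; the
rectangles are arranged diagonally in the order of the vertices. -/
noncomputable def offX (D : Diagram V E) (v : V) : ℝ := ∑ᶠ u ∈ {u | D.ltV u v}, D.wp.vert u

/-- Lower endpoint of the vertical side `Y_v` of the rectangle of `v`. -/
noncomputable def offY (D : Diagram V E) (v : V) : ℝ := ∑ᶠ u ∈ {u | D.ltV u v}, D.wm.vert u

/-- The interior of `X_v`; its length is `w⁺(v)`. -/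
noncomputable def sideX (D : Diagram V E) (v : V) : Set ℝ :=
  Set.Ioo (D.offX v) (D.offX v + D.wp.vert v)

/-- The interior of `Y_v`; its length is `w⁻(v)`. -/
noncomputable def sideY (D : Diagram V E) (v : V) : Set ℝ :=
  Set.Ioo (D.offY v) (D.offY v + D.wm.vert v)

/-- The cutting and stacking map `T` of the positive half, which glues horizontal sides. -/
def mapT (D : Diagram V E) : ℝ → ℝ → Prop := D.toOrderedBratteli.CutStackMap D.wp

/-- The cutting and stacking map `S` of the negative half, which glues vertical sides. -/
def mapS (D : Diagram V E) : ℝ → ℝ → Prop := D.toOrderedBratteli.rev.CutStackMap D.wm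

/-- The identifications of boundary points: `top a` with `bottom (T a)`, and `right a` with
`left (S a)`. -/
inductive Glue (D : Diagram V E) : ℝ × ℝ → ℝ × ℝ → Prop
  | vertical (u v : V) (a b : ℝ) (hu : D.lev u = 0) (hv : D.lev v = 0)
      (ha : a ∈ D.sideX u) (hb : b ∈ D.sideX v) (hab : D.mapT a b) :
      Glue D (a, D.offY u + D.wm.vert u) (b, D.offY v)
  | horizontal (u v : V) (a b : ℝ) (hu : D.lev u = 0) (hv : D.lev v = 0)
      (ha : a ∈ D.sideY u) (hb : b ∈ D.sideY v) (hab : D.mapS a b) :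
      Glue D (D.offX u + D.wp.vert u, a) (D.offX v, b)

/-- The gluing data `S(𝓑, w^±, ≤_{r,s})`: the rectangles, from whose boundaries all corners and all
points which take part in no identification are removed, with their sides glued. -/
def gluing (D : Diagram V E) : PlanarGluing where
  region := (⋃ v ∈ {v | D.lev v = 0}, D.sideX v ×ˢ D.sideY v) ∪
    {p | ∃ q, D.Glue p q ∨ D.Glue q p}
  rel := Relation.EqvGen.setoid D.Glue

/-! ### Deforming, cutting and stacking -/

/-- The renormalization time `t₁`. -/
noncomputable def time (D : Diagram V E) : ℝ :=
  -Real.log (∑ᶠ v ∈ {v | D.lev v = 1}, D.wp.vertex D.toBiBratteli v)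

/-- The height `h¹_v = w⁻(v)` of the tower of a vertex `v` of level `1`. -/
noncomputable def height (D : Diagram V E) (v : V) : ℝ :=
  ∑ᶠ e ∈ {e | D.r e = v}, D.wm.vert (D.s e)

/-- Left endpoint of the piece of `X_{s(e)}` that belongs to an edge `e` between the levels `0` and
`1`, when `X_{s(e)}` is cut in the order of the edges with the same source. -/
noncomputable def cutX (D : Diagram V E) (e : E) : ℝ :=
  D.offX (D.s e) + D.wp.vert (D.s e) * ∑ᶠ f ∈ {f | D.ltS f e}, D.wp.edge f

/-- The (closed) sub-rectangle of the edge `e`, of full height, before the deformation. -/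
noncomputable def piece (D : Diagram V E) (e : E) : Set (ℝ × ℝ) :=
  Set.Icc (D.cutX e) (D.cutX e + D.wp.vert (D.s e) * D.wp.edge e) ×ˢ
    Set.Icc (D.offY (D.s e)) (D.offY (D.s e) + D.wm.vert (D.s e))

/-- The lower left corner of the place to which the deformed piece of `e` is moved.  The towers of
the vertices of level `1`, of width `exp t₁ * w⁺(v)` and height `exp (-t₁) * h¹_v`, are arranged
diagonally in the order of the vertices; inside the tower of `v` the pieces of the edges with range
`v` are stacked in their order. -/
noncomputable def corner (D : Diagram V E) (e : E) : ℝ × ℝ :=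
  (∑ᶠ u ∈ {u | D.ltV u (D.r e)}, Real.exp D.time * D.wp.vertex D.toBiBratteli u,
   (∑ᶠ u ∈ {u | D.ltV u (D.r e)}, Real.exp (-D.time) * D.height u) +
     ∑ᶠ f ∈ {f | D.ltR f e}, Real.exp (-D.time) * D.wm.vert (D.s f))

/-- The map which deforms the piece of `e` and moves it by a translation to its place. -/
noncomputable def place (D : Diagram V E) (e : E) (p : ℝ × ℝ) : ℝ × ℝ :=
  diagMap D.time p + (D.corner e - diagMap D.time (D.cutX e, D.offY (D.s e)))

/-- Two points are related if they are the new positions of points `p`, `p'` of pieces which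
represent the same point of the original surface. -/
def Moved (D : Diagram V E) (q q' : ℝ × ℝ) : Prop :=
  ∃ e e' p p', D.lev (D.s e) = 0 ∧ D.lev (D.s e') = 0 ∧
    p ∈ D.gluing.region ∩ D.piece e ∧ p' ∈ D.gluing.region ∩ D.piece e' ∧
    D.gluing.rel p p' ∧ q = D.place e p ∧ q' = D.place e' p'

/-- The gluing data `DS(𝓑, w^±, ≤_{r,s})` obtained by deforming for time `t₁`, cutting into the
pieces of the edges between the levels `0` and `1`, and stacking these pieces to towers, while all
identifications of the original surface are kept (the two sides of a cut included). -/
def cutStack (D : Diagram V E) : PlanarGluing where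
  region := {q | ∃ e, D.lev (D.s e) = 0 ∧ ∃ p ∈ D.gluing.region ∩ D.piece e, q = D.place e p}
  rel := Relation.EqvGen.setoid D.Moved

/-- `R` is the map from the surface to the deformed, cut and stacked surface which sends each point
of each piece to its new position. -/
def IsRenormMap (D : Diagram V E) (R : D.gluing.Space → D.cutStack.Space) : Prop :=
  ∀ e, D.lev (D.s e) = 0 → ∀ p : D.gluing.region, (p : ℝ × ℝ) ∈ D.piece e →
    ∃ h : D.place e p ∈ D.cutStack.region, R (D.gluing.proj p) = D.cutStack.proj ⟨D.place e p, h⟩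

end Diagram

/-! ### The shift of a diagram -/

namespace BiBratteli

theorem IsPath.lev_nonneg {B : BiBratteli V E} :
    ∀ {p : FinPath V E} {v : V}, B.IsPath p v → 0 ≤ B.lev v
  | .start u, v, h => by have := h.2; omega
  | .snoc p e, v, h => by
    have h1 := IsPath.lev_nonneg h.1
    have h2 := B.lev_r e
    rw [← h.2]; omega

theorem initial_isPath {B : BiBratteli V E} {x : ℕ → E} (hx : x ∈ B.pathSpace) (n : ℕ) :
    B.IsPath (B.initial x n) (B.s (x n)) := by
  induction n with
  | zero => exact ⟨rfl, hx.1⟩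
  | succ n ih => exact ⟨ih, hx.2 n⟩

theorem exists_path_one (B : BiBratteli V E) (v : V) (hv : B.lev v = 1) :
    ∃ e, B.lev (B.s e) = 0 ∧ B.IsPath (.snoc (.start (B.s e)) e) v := by
  obtain ⟨e, he⟩ := B.exists_in v
  have := B.lev_r e
  rw [he, hv] at this
  exact ⟨e, by omega, ⟨rfl, by omega⟩, he⟩

end BiBratteli

theorem IsWeightFunction.vertex_eq {B : BiBratteli V E} {w : Weight V E} (hw : IsWeightFunction B w)
    {p : FinPath V E} {v : V} (hp : B.IsPath p v) : w.vertex B v = w.path p := by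
  have h : ∃ p, B.IsPath p v := ⟨p, hp⟩
  rw [Weight.vertex, dif_pos h]
  exact hw.path_eq v _ _ h.choose_spec hp

theorem IsWeightFunction.vertex_edge {B : BiBratteli V E} {w : Weight V E} (hw : IsWeightFunction B w)
    {e : E} (he : B.lev (B.s e) = 0) : w.vertex B (B.r e) = w.vert (B.s e) * w.edge e :=
  hw.vertex_eq (p := .snoc (.start (B.s e)) e) ⟨⟨rfl, he⟩, rfl⟩

theorem IsWeightFunction.vertex_pos {B : BiBratteli V E} {w : Weight V E} (hw : IsWeightFunction B w)
    {v : V} (hv : B.lev v = 1) : 0 < w.vertex B v := by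
  obtain ⟨e, he, hp⟩ := B.exists_path_one v hv
  rw [hw.vertex_eq hp]
  exact mul_pos (hw.vert_pos _ he) (hw.edge_pos _ he.ge)

theorem finsum_mem_pos' {α : Type*} {s : Set α} (hs : s.Finite) (hne : s.Nonempty) {f : α → ℝ}
    (hf : ∀ a ∈ s, 0 < f a) : 0 < ∑ᶠ a ∈ s, f a := by
  rw [finsum_mem_eq_finite_toFinset_sum f hs]
  exact Finset.sum_pos (fun a ha => hf a (hs.mem_toFinset.1 ha)) (by simpa using hne)

namespace Diagram

variable (D : Diagram V E)

theorem finite_in (v : V) : {e | D.r e = v}.Finite :=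
  (D.finite_edges (D.lev v - 1)).subset fun e (he : D.r e = v) =>
    show D.lev (D.s e) = D.lev v - 1 by have := D.lev_r e; rw [he] at this; omega

theorem height_pos {v : V} (hv : D.lev v = 1) : 0 < D.height v := by
  refine finsum_mem_pos' (D.finite_in v) (D.exists_in v) ?_
  intro e (he : D.r e = v)
  refine D.wm_isWeight.vert_pos _ ?_
  have := D.lev_r e
  rw [he] at this
  show -D.lev (D.s e) = 0
  omega

theorem sum_one_pos : 0 < ∑ᶠ v ∈ {v | D.lev v = 1}, D.wp.vertex D.toBiBratteli v :=
  finsum_mem_pos' (D.finite_level 1) (D.nonempty_level 1) fun _ hv => D.wp_isWeight.vertex_pos hv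

/-- The positive weight function of the shift: `w⁺` on edges, and `exp t₁ * w⁺(v)` for a vertex `v`
of the new level `0`. -/
noncomputable def shiftWp : Weight V E where
  vert v := Real.exp D.time * D.wp.vertex D.toBiBratteli v
  edge := D.wp.edge

/-- The negative weight function of the shift: `exp (-t₁) * w⁻(v)` for a vertex `v` of the new level
`0`, `w⁻(s(e)) / w⁻(r(e))` for the edges `e` that join the negative half, and `w⁻` on all other
edges. -/
noncomputable def shiftWm : Weight V E where
  vert v := Real.exp (-D.time) * D.height v
  edge e := open Classical in
    if D.lev (D.s e) = 0 then D.wm.vert (D.s e) / D.height (D.r e) else D.wm.edge e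

theorem shiftWm_edge_zero {e : E} (he : D.lev (D.s e) = 0) :
    D.shiftWm.edge e = D.wm.vert (D.s e) / D.height (D.r e) := if_pos he

theorem shiftWm_edge_ne {e : E} (he : D.lev (D.s e) ≠ 0) :
    D.shiftWm.edge e = D.wm.edge e := if_neg he

theorem finite_out (v : V) : {e | D.s e = v}.Finite :=
  (D.finite_edges (D.lev v)).subset fun e (he : D.s e = v) =>
    show D.lev (D.s e) = D.lev v by rw [he]

/-- A path of the shift extends by one edge to a path of the original diagram. -/
theorem exists_path_shift : ∀ (p : FinPath V E) (v : V), D.toBiBratteli.shift.IsPath p v →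
    ∃ q, D.toBiBratteli.IsPath q v ∧ D.shiftWp.path p = Real.exp D.time * D.wp.path q
  | .start u, v, h => by
    have h1 : D.lev v - 1 = 0 := h.2
    have hu : u = v := h.1
    obtain ⟨e, he, hp⟩ := D.exists_path_one v (by omega)
    refine ⟨_, hp, ?_⟩
    show Real.exp D.time * D.wp.vertex D.toBiBratteli u = _
    rw [hu, D.wp_isWeight.vertex_eq hp]
  | .snoc p e, v, h => by
    obtain ⟨q, hq, hpq⟩ := exists_path_shift p _ h.1
    refine ⟨.snoc q e, ⟨hq, h.2⟩, ?_⟩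
    show D.shiftWp.path p * D.wp.edge e = Real.exp D.time * (D.wp.path q * D.wp.edge e)
    rw [hpq, mul_assoc]

/-- A path of positive length of the negative half of the shift comes from a path of the original
negative half. -/
theorem exists_path_shift_rev : ∀ (p : FinPath V E) (v : V),
    D.toBiBratteli.shift.rev.IsPath p v → D.lev v ≤ 0 →
    ∃ q, D.toBiBratteli.rev.IsPath q v ∧ D.shiftWm.path p = Real.exp (-D.time) * D.wm.path q
  | .start u, v, h, hv => by
    have h1 : -(D.lev v - 1) = 0 := h.2
    omega
  | .snoc p e, v, h, hv => by
    have hs : D.s e = v := h.2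
    have hp : D.toBiBratteli.shift.rev.IsPath p (D.r e) := h.1
    have hl := D.lev_r e
    by_cases h0 : D.lev v = 0
    · cases p with
      | start u =>
        have hu : u = D.r e := hp.1
        refine ⟨.start v, ⟨rfl, ?_⟩, ?_⟩
        · show -D.lev v = 0
          omega
        · have hh : 0 < D.height (D.r e) := D.height_pos (by rw [hl, hs]; omega)
          show Real.exp (-D.time) * D.height u * D.shiftWm.edge e = Real.exp (-D.time) * D.wm.vert v
          rw [D.shiftWm_edge_zero (by rw [hs, h0]), hu, hs]
          field_simp
      | snoc p f =>
        have h1 : D.s f = D.r e := hp.2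
        have h2 : 0 ≤ -(D.lev (D.r f) - 1) := BiBratteli.IsPath.lev_nonneg hp.1
        have h3 := D.lev_r f
        rw [h1, hl, hs] at h3
        omega
    · obtain ⟨q, hq, hpq⟩ := exists_path_shift_rev p _ hp (by rw [hl, hs]; omega)
      refine ⟨.snoc q e, ⟨hq, h.2⟩, ?_⟩
      show D.shiftWm.path p * D.shiftWm.edge e = Real.exp (-D.time) * (D.wm.path q * D.wm.edge e)
      rw [hpq, D.shiftWm_edge_ne (by rw [hs]; exact h0), mul_assoc]

theorem shiftWp_isWeight : IsWeightFunction D.toBiBratteli.shift D.shiftWp where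
  vert_pos v hv := by
    have : D.lev v - 1 = 0 := hv
    exact mul_pos (Real.exp_pos _) (D.wp_isWeight.vertex_pos (by omega))
  edge_pos e he := by
    have : 0 ≤ D.lev (D.s e) - 1 := he
    exact D.wp_isWeight.edge_pos e (by omega)
  path_eq v p q hp hq := by
    obtain ⟨p', hp', h1⟩ := D.exists_path_shift p v hp
    obtain ⟨q', hq', h2⟩ := D.exists_path_shift q v hq
    rw [h1, h2, D.wp_isWeight.path_eq v p' q' hp' hq']
  sum_out v hv := by
    have : 0 ≤ D.lev v - 1 := hv
    exact D.wp_isWeight.sum_out v (by omega)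
  tendsto_zero x hx hinf := by
    have key : ∀ y ∈ D.toBiBratteli.shift.pathSpace, ∃ z ∈ D.toBiBratteli.pathSpace,
        ∀ n, z (n + 1) = y n := by
      intro y hy
      have h0 : D.lev (D.s (y 0)) - 1 = 0 := hy.1
      obtain ⟨e, he⟩ := D.exists_in (D.s (y 0))
      have hl := D.lev_r e
      rw [he] at hl
      refine ⟨fun n => Nat.casesOn n e y, ⟨?_, ?_⟩, fun n => rfl⟩
      · show D.lev (D.s e) = 0
        omega
      · rintro (_ | n)
        · exact he
        · exact hy.2 n
    obtain ⟨z, hz, hzx⟩ := key x hx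
    have hzinf : (D.tailClass z).Infinite := by
      intro hfin
      refine hinf ((hfin.image fun y n => y (n + 1)).subset ?_)
      rintro y ⟨hy, N, hN⟩
      obtain ⟨u, hu, huy⟩ := key y hy
      refine ⟨u, ⟨hu, N + 1, ?_⟩, funext huy⟩
      rintro (_ | k) hk
      · omega
      · rw [hzx, huy, hN k (by omega)]
    have hlim := ((D.wp_isWeight.tendsto_zero z hz hzinf).comp (tendsto_add_atTop_nat 1)).const_mul
      (Real.exp D.time)
    rw [mul_zero] at hlim
    refine hlim.congr fun n => ?_
    induction n with
    | zero =>
      show _ = Real.exp D.time * D.wp.vertex D.toBiBratteli (D.s (x 0))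
      rw [← hzx 0, D.wp_isWeight.vertex_eq (BiBratteli.initial_isPath hz 1)]
      rfl
    | succ n ih =>
      show Real.exp D.time * (D.wp.path (D.initial z (n + 1)) * D.wp.edge (z (n + 1))) =
        D.shiftWp.path (D.toBiBratteli.shift.initial x n) * D.wp.edge (x n)
      rw [← ih, hzx n, ← mul_assoc]
      rfl

theorem shiftWm_isWeight : IsWeightFunction D.toBiBratteli.shift.rev D.shiftWm where
  vert_pos v hv := by
    have : -(D.lev v - 1) = 0 := hv
    exact mul_pos (Real.exp_pos _) (D.height_pos (by omega))
  edge_pos e he := by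
    have h1 : 0 ≤ -(D.lev (D.r e) - 1) := he
    have h2 := D.lev_r e
    by_cases h : D.lev (D.s e) = 0
    · rw [D.shiftWm_edge_zero h]
      exact div_pos (D.wm_isWeight.vert_pos _ (show -D.lev (D.s e) = 0 by omega))
        (D.height_pos (by omega))
    · rw [D.shiftWm_edge_ne h]
      exact D.wm_isWeight.edge_pos e (show 0 ≤ -D.lev (D.r e) by omega)
  path_eq v p q hp hq := by
    by_cases hv : D.lev v ≤ 0
    · obtain ⟨p', hp', h1⟩ := D.exists_path_shift_rev p v hp hv
      obtain ⟨q', hq', h2⟩ := D.exists_path_shift_rev q v hq hv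
      rw [h1, h2, D.wm_isWeight.path_eq v p' q' hp' hq']
    · have key : ∀ p, D.toBiBratteli.shift.rev.IsPath p v → p = .start v := by
        rintro (u | ⟨p, e⟩) h
        · rw [show u = v from h.1]
        · have h1 : 0 ≤ -(D.lev (D.r e) - 1) := BiBratteli.IsPath.lev_nonneg h.1
          have h2 := D.lev_r e
          rw [show D.s e = v from h.2] at h2
          omega
      rw [key p hp, key q hq]
  sum_out v hv := by
    have hv' : 0 ≤ -(D.lev v - 1) := hv
    show ∑ᶠ e ∈ {e | D.r e = v}, D.shiftWm.edge e = 1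
    by_cases h1 : D.lev v = 1
    · have : ∀ e ∈ {e | D.r e = v}, D.shiftWm.edge e = (D.height v)⁻¹ * D.wm.vert (D.s e) := by
        intro e (he : D.r e = v)
        have h2 := D.lev_r e
        rw [D.shiftWm_edge_zero (by rw [he] at h2; omega), he, div_eq_inv_mul]
      rw [finsum_mem_congr rfl this, ← mul_finsum_mem]
      exact inv_mul_cancel₀ (D.height_pos h1).ne'
    · rw [← D.wm_isWeight.sum_out v (show 0 ≤ -D.lev v by omega)]
      refine finsum_mem_congr rfl fun e (he : D.r e = v) => ?_
      have h2 := D.lev_r e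
      rw [D.shiftWm_edge_ne (by rw [he] at h2; omega)]
  tendsto_zero x hx hinf := by
    have key : ∀ y ∈ D.toBiBratteli.shift.rev.pathSpace,
        (fun n => y (n + 1)) ∈ D.toBiBratteli.rev.pathSpace := by
      intro y hy
      have h0 : -(D.lev (D.r (y 0)) - 1) = 0 := hy.1
      have h1 : D.s (y 0) = D.r (y 1) := hy.2 0
      have h2 := D.lev_r (y 0)
      refine ⟨?_, fun n => hy.2 (n + 1)⟩
      show -D.lev (D.r (y 1)) = 0
      rw [← h1]
      omega
    have hfe : {e | D.lev (D.s e) = 0}.Finite := D.finite_edges 0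
    have hzinf : (D.toBiBratteli.rev.tailClass fun n => x (n + 1)).Infinite := by
      intro hfin
      refine hinf (((hfe.prod hfin).image
        fun t : E × (ℕ → E) => (fun n => Nat.casesOn n t.1 t.2 : ℕ → E)).subset ?_)
      rintro y ⟨hy, N, hN⟩
      refine ⟨(y 0, fun n => y (n + 1)), ⟨?_, key y hy, N, fun k hk => hN _ (by omega)⟩, ?_⟩
      · have h0 : -(D.lev (D.r (y 0)) - 1) = 0 := hy.1
        have h2 := D.lev_r (y 0)
        show D.lev (D.s (y 0)) = 0
        omega
      · funext n
        cases n <;> rfl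
    have hlim := (D.wm_isWeight.tendsto_zero _ (key x hx) hzinf).const_mul (Real.exp (-D.time))
    rw [mul_zero] at hlim
    rw [← tendsto_add_atTop_iff_nat 1]
    refine hlim.congr fun n => ?_
    have hp := BiBratteli.initial_isPath hx (n + 1)
    have hp' := BiBratteli.initial_isPath (key x hx) n
    have hle : 0 ≤ -D.lev (D.r (x (n + 1))) := BiBratteli.IsPath.lev_nonneg hp'
    obtain ⟨q, hq, h1⟩ := D.exists_path_shift_rev _ _ hp
      (show D.lev (D.r (x (n + 1))) ≤ 0 by omega)
    rw [h1, D.wm_isWeight.path_eq _ _ _ hp' hq]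

theorem shift_wp_sum :
    ∑ᶠ v ∈ {v | D.lev v - 1 = 0}, D.shiftWp.vert v = 1 := by
  have hset : {v | D.lev v - 1 = 0} = {v | D.lev v = 1} := by
    ext v
    show D.lev v - 1 = 0 ↔ D.lev v = 1
    omega
  rw [hset]
  show ∑ᶠ v ∈ {v | D.lev v = 1}, Real.exp D.time * D.wp.vertex D.toBiBratteli v = 1
  rw [← mul_finsum_mem, time, Real.exp_neg, Real.exp_log D.sum_one_pos]
  exact inv_mul_cancel₀ D.sum_one_pos.ne'

theorem shift_area :
    ∑ᶠ v ∈ {v | D.lev v - 1 = 0}, D.shiftWp.vert v * D.shiftWm.vert v = 1 := by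
  classical
  have hset : {v | D.lev v - 1 = 0} = {v | D.lev v = 1} := by
    ext v
    show D.lev v - 1 = 0 ↔ D.lev v = 1
    omega
  rw [hset, ← D.area]
  have hE := D.finite_edges 0
  have h0 := D.finite_level 0
  have h1 := D.finite_level 1
  set F : E → ℝ := fun e => D.wp.vert (D.s e) * D.wp.edge e * D.wm.vert (D.s e) with hF
  rw [finsum_mem_eq_finite_toFinset_sum _ h0, finsum_mem_eq_finite_toFinset_sum _ h1]
  trans ∑ e ∈ hE.toFinset, F e
  · rw [← Finset.sum_fiberwise_of_maps_to (t := h1.toFinset) (g := D.r)]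
    · refine Finset.sum_congr rfl fun v hv => ?_
      have hv1 : D.lev v = 1 := h1.mem_toFinset.1 hv
      show Real.exp D.time * D.wp.vertex D.toBiBratteli v * (Real.exp (-D.time) * D.height v) = _
      rw [mul_mul_mul_comm, ← Real.exp_add, add_neg_cancel, Real.exp_zero, one_mul, height,
        finsum_mem_eq_finite_toFinset_sum _ (D.finite_in v), Finset.mul_sum]
      refine Finset.sum_congr ?_ fun e he => ?_
      · ext e
        have h2 := D.lev_r e
        rw [Set.Finite.mem_toFinset, Finset.mem_filter, Set.Finite.mem_toFinset]
        show D.r e = v ↔ D.lev (D.s e) = 0 ∧ D.r e = v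
        refine ⟨fun h => ⟨?_, h⟩, fun h => h.2⟩
        rw [h, hv1] at h2
        omega
      · have hev : D.r e = v := (Finset.mem_filter.1 he).2
        have h2 := D.lev_r e
        have h3 : D.lev (D.s e) = 0 := by rw [hev, hv1] at h2; omega
        rw [← hev, D.wp_isWeight.vertex_edge h3]
    · intro e he
      have h3 : D.lev (D.s e) = 0 := hE.mem_toFinset.1 he
      have h2 := D.lev_r e
      exact h1.mem_toFinset.2 (show D.lev (D.r e) = 1 by omega)
  · rw [← Finset.sum_fiberwise_of_maps_to (t := h0.toFinset) (g := D.s)]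
    · refine Finset.sum_congr rfl fun v hv => ?_
      have hv0 : D.lev v = 0 := h0.mem_toFinset.1 hv
      have h4 := D.wp_isWeight.sum_out v hv0.ge
      rw [finsum_mem_eq_finite_toFinset_sum _ (D.finite_out v)] at h4
      trans ∑ e ∈ (D.finite_out v).toFinset, D.wp.vert v * D.wm.vert v * D.wp.edge e
      · refine Finset.sum_congr ?_ fun e he => ?_
        · ext e
          rw [Set.Finite.mem_toFinset, Finset.mem_filter, Set.Finite.mem_toFinset]
          show D.lev (D.s e) = 0 ∧ D.s e = v ↔ D.s e = v
          exact ⟨fun h => h.2, fun h => ⟨by rw [h, hv0], h⟩⟩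
        · rw [hF]
          have hev : D.s e = v := (D.finite_out v).mem_toFinset.1 he
          simp only [hev]
          ring
      · rw [← Finset.mul_sum, h4, mul_one]
    · intro e he
      exact h0.mem_toFinset.2 (hE.mem_toFinset.1 he)

/-- The shift `σ(𝓑, w^±, ≤_{r,s})` of a diagram. -/
noncomputable def shift : Diagram V E where
  toOrderedBratteli := D.toOrderedBratteli.shift
  wp := D.shiftWp
  wm := D.shiftWm
  wp_isWeight := D.shiftWp_isWeight
  wm_isWeight := D.shiftWm_isWeight
  wp_sum := D.shift_wp_sum
  area := D.shift_area

end Diagram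

end Bratteli

/-!
The heart of the matter is that cutting and stacking commutes with dropping the first stage.  If the
stage-`0` intervals over the vertices of level `0` are cut once and stacked once, the columns of
stage `1` become the stage-`0` intervals of the shifted diagram, up to the scaling by `exp t₁`
(`Half.IsShift`, `Half.move`).  Under this identification the map `T` of the old diagram splits into
two kinds of moves (`Half.IsShift.T_iff`): either a point goes one level up inside its column of
stage `1`, or it goes from the top level of a column to the bottom level of a column and follows the
map `T'` of the shift.

For the positive half, the diagram is the longer one and its shift is the shorter one.  For the
negative half it is the other way round: reversed, the negative half of the shift has one stage more
than that of the diagram.  So the pair of a diagram and its shift is symmetric under exchanging the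
coordinates together with the roles of the two surfaces (`Half.Renorm.swap`), and only one direction
of each of the following statements needs an argument.

When the rectangles are cut along vertical lines and the pieces are stacked, the gluings transform
as follows.  A top-to-bottom gluing of the first kind turns into the inside of a tower, where two
pieces are stacked, and one of the second kind turns into a top-to-bottom gluing of the shift
(`Half.Renorm.vGlue_corr`).  A right-to-left gluing is one of the second kind for the map of the
shift (`Half.Renorm.hGlue_corr`), and the two sides of a cut are glued by a move of the first kind
(`Half.Renorm.cut_corr`).  Hence old and new positions of points correspond to each other with
regions and identifications (`Half.Renorm.inRegion_corr_iff`, `Half.Renorm.eqvGen_corr_iff`), which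
gives the equality of the two gluing data.  Finally, the pieces are closed and finite in number and
are moved by `diagMap t₁` up to translations, so that the induced bijection of the quotients is a
homeomorphism which matches the charts (`PlanarGluing.PieceIso.exists_isIso`).
-/

namespace Bratteli

variable {V E : Type*}

/-! ### Finite total orders on the fibers of a map -/

/-- A partial order on `α` for which two elements are comparable iff they lie in the same fiber of
`π`, all fibers being finite. -/
structure FiberOrder {α β : Type*} (le : α → α → Prop) (π : α → β) : Prop where
  antisymm : ∀ a b, le a b → le b a → a = b
  trans : ∀ a b c, le a b → le b c → le a c
  comparable : ∀ a b, (le a b ∨ le b a) ↔ π a = π b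
  finite : ∀ a, {x | π x = π a}.Finite

/-- `b` is the immediate successor of `a` for the strict order of `le`. -/
def Consec {α : Type*} (le : α → α → Prop) (a b : α) : Prop :=
  (le a b ∧ a ≠ b) ∧ ∀ x, ¬ ((le a x ∧ a ≠ x) ∧ (le x b ∧ x ≠ b))

/-- `a` is the largest element of its fiber. -/
def IsFiberMax {α β : Type*} (le : α → α → Prop) (π : α → β) (a : α) : Prop :=
  ∀ x, π x = π a → le x a

/-- `a` is the least element of its fiber. -/
def IsFiberMin {α β : Type*} (le : α → α → Prop) (π : α → β) (a : α) : Prop :=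
  ∀ x, π x = π a → le a x

/-- The total weight of the elements strictly below `a`: the left endpoint of the interval of `a`
when intervals of lengths `w x` are put side by side in the order of the fiber. -/
noncomputable def below {α : Type*} (le : α → α → Prop) (w : α → ℝ) (a : α) : ℝ :=
  ∑ᶠ x ∈ {x | le x a ∧ x ≠ a}, w x

namespace FiberOrder

variable {α β : Type*} {le : α → α → Prop} {π : α → β} {w : α → ℝ} {a b : α}

theorem refl (h : FiberOrder le π) (a : α) : le a a := by
  simpa using (h.comparable a a).2 rfl

theorem proj_eq (h : FiberOrder le π) (hab : le a b) : π a = π b :=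
  (h.comparable a b).1 (Or.inl hab)

theorem finite_le (h : FiberOrder le π) (a : α) : {x | le x a}.Finite :=
  (h.finite a).subset fun _ hx => h.proj_eq hx

theorem finite_lt (h : FiberOrder le π) (a : α) : {x | le x a ∧ x ≠ a}.Finite :=
  (h.finite_le a).subset fun _ hx => hx.1

theorem lt_or_le (h : FiberOrder le π) (hab : π a = π b) : (le a b ∧ a ≠ b) ∨ le b a := by
  by_cases he : a = b
  · exact Or.inr (he ▸ h.refl a)
  · exact ((h.comparable a b).2 hab).imp_left fun h1 => ⟨h1, he⟩

theorem trichotomy (h : FiberOrder le π) (hab : π a = π b) (hne : a ≠ b) :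
    (le a b ∧ a ≠ b) ∨ (le b a ∧ b ≠ a) :=
  ((h.comparable a b).2 hab).imp (fun h1 => ⟨h1, hne⟩) fun h1 => ⟨h1, hne.symm⟩

theorem below_add (h : FiberOrder le π) (w : α → ℝ) (a : α) :
    below le w a + w a = ∑ᶠ x ∈ {x | le x a}, w x := by
  have hs : {x | le x a} = insert a {x | le x a ∧ x ≠ a} := by
    ext x
    by_cases hx : x = a <;> simp [hx, h.refl]
  rw [hs, finsum_mem_insert w (by simp) (h.finite_lt a), add_comm, below]

theorem finsum_mem_mono_set {s t : Set α} (ht : t.Finite) (hst : s ⊆ t)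
    (hw : ∀ x ∈ t, 0 < w x) : ∑ᶠ x ∈ s, w x ≤ ∑ᶠ x ∈ t, w x := by
  rw [finsum_mem_eq_finite_toFinset_sum w ht, finsum_mem_eq_finite_toFinset_sum w (ht.subset hst)]
  refine Finset.sum_le_sum_of_subset_of_nonneg (by simpa using hst) fun x hx _ => ?_
  exact (hw x (by simpa using hx)).le

theorem below_nonneg (h : FiberOrder le π) (hw : ∀ x, π x = π a → 0 < w x) :
    0 ≤ below le w a := by
  exact finsum_nonneg fun x => finsum_nonneg fun hx => (hw x (h.proj_eq hx.1)).le

theorem below_add_le (h : FiberOrder le π) (hw : ∀ x, π x = π b → 0 < w x)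
    (hab : le a b ∧ a ≠ b) : below le w a + w a ≤ below le w b := by
  rw [h.below_add]
  refine finsum_mem_mono_set (h.finite_lt b) (fun x hx => ⟨h.trans _ _ _ hx hab.1, ?_⟩)
    fun x hx => hw x (h.proj_eq hx.1)
  rintro rfl
  exact hab.2 (h.antisymm _ _ hab.1 hx)

theorem below_lt (h : FiberOrder le π) (hw : ∀ x, π x = π b → 0 < w x)
    (hab : le a b ∧ a ≠ b) : below le w a < below le w b := by
  have := h.below_add_le hw hab
  have := hw a (h.proj_eq hab.1)
  linarith

theorem below_add_le_total (h : FiberOrder le π) (hw : ∀ x, π x = π a → 0 < w x) :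
    below le w a + w a ≤ ∑ᶠ x ∈ {x | π x = π a}, w x := by
  rw [h.below_add]
  exact finsum_mem_mono_set (h.finite a) (fun x hx => h.proj_eq hx) hw

theorem below_consec (h : FiberOrder le π) (hab : Consec le a b) :
    below le w b = below le w a + w a := by
  suffices hs : {x | le x b ∧ x ≠ b} = {x | le x a} by rw [h.below_add, below, hs]
  ext x
  refine ⟨fun hx => ?_, fun hx => ⟨h.trans _ _ _ hx hab.1.1, ?_⟩⟩
  · rcases h.lt_or_le (a := a) (b := x)
      ((h.proj_eq hab.1.1).trans (h.proj_eq hx.1).symm) with h1 | h1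
    · exact (hab.2 x ⟨h1, hx⟩).elim
    · exact h1
  · rintro rfl
    exact hab.1.2 (h.antisymm _ _ hab.1.1 hx)

theorem below_max (h : FiberOrder le π) (ha : IsFiberMax le π a) :
    below le w a + w a = ∑ᶠ x ∈ {x | π x = π a}, w x := by
  rw [h.below_add]
  have : {x | le x a} = {x | π x = π a} := Set.ext fun x => ⟨h.proj_eq, ha x⟩
  rw [this]

theorem below_min (h : FiberOrder le π) (ha : IsFiberMin le π a) : below le w a = 0 := by
  have : {x | le x a ∧ x ≠ a} = ∅ := by
    ext x
    simp only [Set.mem_ofPred_eq, Set.mem_empty_iff_false, iff_false, not_and, not_not]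
    exact fun hx => h.antisymm _ _ hx (ha x (h.proj_eq hx))
  rw [below, this, finsum_mem_empty]

/-- An element that is not the largest of its fiber has an immediate successor. -/
theorem max_or_consec (h : FiberOrder le π) (a : α) :
    IsFiberMax le π a ∨ ∃ b, Consec le a b := by
  by_cases hne : {b | le a b ∧ a ≠ b}.Nonempty
  · right
    have hf : {b | le a b ∧ a ≠ b}.Finite :=
      (h.finite a).subset fun _ hx => (h.proj_eq hx.1).symm
    obtain ⟨b, hb, hmin⟩ := Set.exists_min_image _ (below le fun _ => (1 : ℝ)) hf hne
    refine ⟨b, hb, fun x hx => ?_⟩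
    exact (h.below_lt (fun _ _ => one_pos) hx.2).not_ge (hmin x hx.1)
  · left
    intro x hx
    rcases h.lt_or_le hx.symm with h1 | h1
    · exact (hne ⟨x, h1⟩).elim
    · exact h1

/-- An element that is not the least of its fiber has an immediate predecessor. -/
theorem min_or_consec (h : FiberOrder le π) (a : α) :
    IsFiberMin le π a ∨ ∃ b, Consec le b a := by
  by_cases hne : {b | le b a ∧ b ≠ a}.Nonempty
  · right
    obtain ⟨b, hb, hmax⟩ := Set.exists_max_image _ (below le fun _ => (1 : ℝ)) (h.finite_lt a) hne
    refine ⟨b, hb, fun x hx => ?_⟩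
    exact (h.below_lt (fun _ _ => one_pos) hx.1).not_ge (hmax x hx.2)
  · left
    intro x hx
    rcases h.lt_or_le hx with h1 | h1
    · exact (hne ⟨x, h1⟩).elim
    · exact h1

theorem exists_min (h : FiberOrder le π) (a : α) : ∃ b, π b = π a ∧ IsFiberMin le π b := by
  obtain ⟨b, hb, hmin⟩ :=
    Set.exists_min_image _ (below le fun _ => (1 : ℝ)) (h.finite a) ⟨a, rfl⟩
  refine ⟨b, hb, ?_⟩
  rcases h.min_or_consec b with h1 | ⟨c, hc⟩
  · exact h1
  · have := hmin c ((h.proj_eq hc.1.1).trans hb)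
    exact ((h.below_lt (fun _ _ => one_pos) hc.1).not_ge this).elim

theorem max_of_below (h : FiberOrder le π) (hw : ∀ x, π x = π a → 0 < w x)
    (ha : ∑ᶠ x ∈ {x | π x = π a}, w x ≤ below le w a + w a) : IsFiberMax le π a := by
  refine (h.max_or_consec a).resolve_right ?_
  rintro ⟨b, hb⟩
  have hπ := h.proj_eq hb.1.1
  have h1 := h.below_consec (w := w) hb
  have h2 := h.below_add_le_total (a := b) (fun x hx => hw x (hx.trans hπ.symm))
  rw [← hπ] at h2
  have := hw b hπ.symm
  linarith

theorem min_of_below (h : FiberOrder le π) (hw : ∀ x, π x = π a → 0 < w x)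
    (ha : below le w a ≤ 0) : IsFiberMin le π a := by
  refine (h.min_or_consec a).resolve_right ?_
  rintro ⟨b, hb⟩
  have hπ := h.proj_eq hb.1.1
  have h1 := h.below_consec (w := w) hb
  have h2 := h.below_nonneg (a := b) (fun x hx => hw x (hx.trans hπ))
  have := hw b hπ
  linarith

/-- The intervals of the elements of a fiber cover the interval of the total weight. -/
theorem exists_below (h : FiberOrder le π) (a₀ : α) (hw : ∀ x, π x = π a₀ → 0 < w x) {y : ℝ}
    (h0 : 0 ≤ y) (h1 : y ≤ ∑ᶠ x ∈ {x | π x = π a₀}, w x) :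
    ∃ a, π a = π a₀ ∧ below le w a ≤ y ∧ y ≤ below le w a + w a := by
  obtain ⟨m, hm, hbot⟩ := h.exists_min a₀
  obtain ⟨a, ⟨ha, hay⟩, hmax⟩ := Set.exists_max_image {x | π x = π a₀ ∧ below le w x ≤ y}
    (below le w) ((h.finite a₀).subset fun _ hx => hx.1)
    ⟨m, hm, by rw [h.below_min hbot]; exact h0⟩
  refine ⟨a, ha, hay, ?_⟩
  rcases h.max_or_consec a with htop | ⟨b, hb⟩
  · rw [h.below_max htop, ha]
    exact h1
  · have hb' := (h.proj_eq hb.1.1).symm.trans ha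
    rw [← h.below_consec hb]
    by_contra hlt
    exact (h.below_lt (fun x hx => hw x (hx.trans hb')) hb.1).not_ge
      (hmax b ⟨hb', (not_le.1 hlt).le⟩)

/-- An interior point of the interval of `a` lies in no other closed interval of the fiber. -/
theorem eq_of_below (h : FiberOrder le π) (hab : π a = π b) (hw : ∀ x, π x = π b → 0 < w x)
    {y : ℝ} (h1 : below le w a < y) (h2 : y < below le w a + w a)
    (h3 : below le w b ≤ y) (h4 : y ≤ below le w b + w b) : a = b := by
  by_contra hne
  rcases h.trichotomy hab hne with h5 | h5
  · have := h.below_add_le hw h5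
    linarith
  · have := h.below_add_le (fun x hx => hw x (hx.trans hab)) h5
    linarith

/-- Two different closed intervals meet only if they are consecutive. -/
theorem consec_of_below (h : FiberOrder le π) (hw : ∀ x, π x = π b → 0 < w x)
    {y : ℝ} (hab : le a b ∧ a ≠ b) (h2 : y ≤ below le w a + w a) (h3 : below le w b ≤ y) :
    Consec le a b ∧ y = below le w a + w a ∧ y = below le w b := by
  have h4 := h.below_add_le hw hab
  refine ⟨⟨hab, fun x ⟨hx, hx'⟩ => ?_⟩, by linarith, by linarith⟩
  have hxb := h.proj_eq hx'.1
  have h5 := h.below_add_le (fun z hz => hw z (hz.trans hxb)) hx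
  have h6 := h.below_add_le hw hx'
  have := hw x hxb
  linarith

end FiberOrder

/-! ### Weighted halves and the columns of cutting and stacking -/

/-- An ordered diagram with a weight function of its positive half.  The negative half of a diagram
is represented by its reversal. -/
structure Half (V E : Type*) where
  B : OrderedBratteli V E
  w : Weight V E
  isWeight : IsWeightFunction B.toBiBratteli w

namespace OrderedBratteli

variable (B : OrderedBratteli V E)

theorem fiberR : FiberOrder B.leR B.r where
  antisymm := B.leR_antisymm
  trans := B.leR_trans
  comparable := B.leR_comparable
  finite a := (B.finite_edges (B.lev (B.r a) - 1)).subset fun e (he : B.r e = B.r a) =>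
    show B.lev (B.s e) = B.lev (B.r a) - 1 by have := B.lev_r e; rw [he] at this; omega

theorem fiberS : FiberOrder B.leS B.s where
  antisymm := B.leS_antisymm
  trans := B.leS_trans
  comparable := B.leS_comparable
  finite a := (B.finite_edges (B.lev (B.s a))).subset fun e (he : B.s e = B.s a) =>
    show B.lev (B.s e) = B.lev (B.s a) by rw [he]

theorem fiberV : FiberOrder B.leV B.lev where
  antisymm := B.leV_antisymm
  trans := B.leV_trans
  comparable := B.leV_comparable
  finite a := B.finite_level (B.lev a)

end OrderedBratteli

namespace Half

variable (H H' : Half V E) {c : ℝ}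

/-- Left endpoint of the column of stage `0` over `v`. -/
noncomputable def off (v : V) : ℝ := H.B.left H.w (.start v)

/-- Left endpoint of the level of the edge `e` in its column of stage `1`. -/
noncomputable def cellL (e : E) : ℝ := H.B.left H.w (.snoc (.start (H.B.s e)) e)

/-- Width of the level of the edge `e` in its column of stage `1`. -/
noncomputable def cellW (e : E) : ℝ := H.w.vert (H.B.s e) * H.w.edge e

/-- The cutting and stacking map. -/
def T : ℝ → ℝ → Prop := H.B.CutStackMap H.w

/-- The open interval over `v` of stage `0`. -/
noncomputable def side (v : V) : Set ℝ := Set.Ioo (H.off v) (H.off v + H.w.vert v)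

/-- The open level of the edge `e` in its column of stage `1`. -/
noncomputable def cell (e : E) : Set ℝ := Set.Ioo (H.cellL e) (H.cellL e + H.cellW e)

theorem cellL_eq (e : E) :
    H.cellL e = H.off (H.B.s e) + H.w.vert (H.B.s e) * below H.B.leS H.w.edge e := rfl

variable {H H'} {a b : ℝ} {u v : V} {e f : E}

theorem end_unique {p : FinPath V E} (hu : H.B.IsPath p u) (hv : H.B.IsPath p v) : u = v := by
  cases p with
  | start _ => exact hu.1.symm.trans hv.1
  | snoc _ _ => exact hu.2.symm.trans hv.2

theorem lev_source_eq (hr : H.B.r e = H.B.r f) : H.B.lev (H.B.s e) = H.B.lev (H.B.s f) := by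
  have h1 := H.B.lev_r e
  have h2 := H.B.lev_r f
  rw [hr] at h1
  omega

theorem path_pos {p : FinPath V E} {v : V} (hp : H.B.IsPath p v) : 0 < H.w.path p := by
  induction p generalizing v with
  | start u =>
    obtain ⟨rfl, h⟩ := hp
    exact H.isWeight.vert_pos _ h
  | snoc p e ih => exact mul_pos (ih hp.1) (H.isWeight.edge_pos _ (BiBratteli.IsPath.lev_nonneg hp.1))

theorem edge_pos_of_source (hv : 0 ≤ H.B.lev (H.B.s e)) :
    ∀ x, H.B.s x = H.B.s e → 0 < H.w.edge x :=
  fun x hx => H.isWeight.edge_pos x (hx ▸ hv)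

theorem vert_pos_of_level (hv : H.B.lev v = 0) : ∀ x, H.B.lev x = H.B.lev v → 0 < H.w.vert x :=
  fun x hx => H.isWeight.vert_pos x (hx.trans hv)

theorem below_edge_nonneg (he : 0 ≤ H.B.lev (H.B.s e)) : 0 ≤ below H.B.leS H.w.edge e :=
  H.B.fiberS.below_nonneg (edge_pos_of_source he)

theorem below_edge_le (he : 0 ≤ H.B.lev (H.B.s e)) :
    below H.B.leS H.w.edge e + H.w.edge e ≤ 1 := by
  have := H.B.fiberS.below_add_le_total (edge_pos_of_source he)
  rwa [H.isWeight.sum_out _ he] at this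

/-- The level of a longer path is contained in the level that it was cut from. -/
theorem level_snoc_subset {p : FinPath V E} (hp : H.B.IsPath p (H.B.s e)) :
    H.B.level H.w (.snoc p e) ⊆ H.B.level H.w p := by
  have h0 := path_pos hp
  have hl := BiBratteli.IsPath.lev_nonneg hp
  have h1 := mul_nonneg h0.le (below_edge_nonneg hl)
  have h2 := mul_le_mul_of_nonneg_left (below_edge_le hl) h0.le
  refine Set.Ioo_subset_Ioo ?_ ?_
  · show _ ≤ H.B.left H.w p + H.w.path p * below H.B.leS H.w.edge e
    linarith
  · show H.B.left H.w p + H.w.path p * below H.B.leS H.w.edge e + H.w.path p * H.w.edge e ≤ _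
    linarith

/-- The levels of a stage are pairwise disjoint. -/
theorem eq_of_mem_level : ∀ {p q : FinPath V E} {u v : V}, H.B.IsPath p u → H.B.IsPath q v →
    H.B.lev u = H.B.lev v → a ∈ H.B.level H.w p → a ∈ H.B.level H.w q → p = q
  | .start _, .start _, u, v, ⟨rfl, hu⟩, ⟨rfl, hv⟩, _, hp, hq => by
    rw [H.B.fiberV.eq_of_below (hu.trans hv.symm) (vert_pos_of_level hv) hp.1 hp.2 hq.1.le hq.2.le]
  | .start _, .snoc q f, u, v, hu, hv, h, hp, hq => by
    have h1 := BiBratteli.IsPath.lev_nonneg hv.1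
    have h2 := H.B.lev_r f
    rw [hv.2] at h2
    have := hu.2
    omega
  | .snoc q f, .start _, v, u, hv, hu, h, hp, hq => by
    have h1 := BiBratteli.IsPath.lev_nonneg hv.1
    have h2 := H.B.lev_r f
    rw [hv.2] at h2
    have := hu.2
    omega
  | .snoc p e, .snoc q f, u, v, hu, hv, h, hp, hq => by
    have h1 := H.B.lev_r e
    have h2 := H.B.lev_r f
    rw [hu.2] at h1
    rw [hv.2] at h2
    obtain rfl := eq_of_mem_level hu.1 hv.1 (by omega) (level_snoc_subset hu.1 hp)
      (level_snoc_subset hv.1 hq)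
    have h0 := path_pos hu.1
    have hs : H.B.s e = H.B.s f := end_unique hu.1 hv.1
    have e1 : below H.B.leS H.w.edge e < (a - H.B.left H.w p) / H.w.path p := by
      rw [lt_div_iff₀ h0]
      have := hp.1
      change H.B.left H.w p + H.w.path p * below H.B.leS H.w.edge e < a at this
      linarith
    have e2 : (a - H.B.left H.w p) / H.w.path p < below H.B.leS H.w.edge e + H.w.edge e := by
      rw [div_lt_iff₀ h0]
      have := hp.2
      change a < H.B.left H.w p + H.w.path p * below H.B.leS H.w.edge e + H.w.path p * H.w.edge e
        at this
      linarith
    have e3 : below H.B.leS H.w.edge f < (a - H.B.left H.w p) / H.w.path p := by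
      rw [lt_div_iff₀ h0]
      have := hq.1
      change H.B.left H.w p + H.w.path p * below H.B.leS H.w.edge f < a at this
      linarith
    have e4 : (a - H.B.left H.w p) / H.w.path p < below H.B.leS H.w.edge f + H.w.edge f := by
      rw [div_lt_iff₀ h0]
      have := hq.2
      change a < H.B.left H.w p + H.w.path p * below H.B.leS H.w.edge f + H.w.path p * H.w.edge f
        at this
      linarith
    rw [H.B.fiberS.eq_of_below hs (edge_pos_of_source (BiBratteli.IsPath.lev_nonneg hv.1)) e1 e2 e3.le e4.le]

end Half

/-! ### Splitting off the first edge of a path -/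

namespace FinPath

/-- The first vertex of a path. -/
def first : FinPath V E → V
  | .start v => v
  | .snoc p _ => p.first

/-- The path obtained by putting the edge `e` in front; `s` is the source map. -/
def cons (s : E → V) (e : E) : FinPath V E → FinPath V E
  | .start _ => .snoc (.start (s e)) e
  | .snoc p f => .snoc (p.cons s e) f

end FinPath

namespace Half

variable {H H' : Half V E} {c : ℝ} {a b : ℝ} {u v : V} {e f : E} {p q : FinPath V E} {x y : ℕ → E}

theorem lev_first (hp : H.B.IsPath p v) : H.B.lev p.first = 0 := by
  induction p generalizing v with
  | start u => obtain ⟨rfl, hp⟩ := hp; exact hp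
  | snoc p g ih => exact ih hp.1

theorem pathLt_asymm (hpq : H.B.pathLt p q) : ¬ H.B.pathLt q p := by
  induction p generalizing q with
  | start u => exact hpq.elim
  | snoc p e ih =>
    cases q with
    | start u => exact hpq.elim
    | snoc q f =>
      rintro (h1 | ⟨rfl, h1⟩)
      · rcases hpq with h2 | ⟨rfl, h2⟩
        · exact h1.2 (H.B.leR_antisymm _ _ h1.1 h2.1)
        · exact h1.2 rfl
      · rcases hpq with h2 | ⟨-, h2⟩
        · exact h2.2 rfl
        · exact ih h2 h1

/-- `H'` is obtained from `H` by dropping the first stage and rescaling by `c`: its levels are those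
of `H` shifted by one, and over a vertex of its level `0` it has the interval of the column of
stage `1` of `H`, scaled by `c`. -/
structure IsShift (H H' : Half V E) (c : ℝ) : Prop where
  lev : ∀ v, H'.B.lev v = H.B.lev v - 1
  s : H'.B.s = H.B.s
  r : H'.B.r = H.B.r
  leR : H'.B.leR = H.B.leR
  leS : H'.B.leS = H.B.leS
  pos : 0 < c
  vert : ∀ e, H.B.lev (H.B.s e) = 0 → H'.w.vert (H.B.r e) = c * H.cellW e
  edge : ∀ e, 0 < H.B.lev (H.B.s e) → H'.w.edge e = H.w.edge e

/-- The affine map that carries the level of the edge `e` in its column of stage `1` of `H` onto the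
interval of the vertex `r e` of level `0` of the shift `H'`. -/
noncomputable def move (H H' : Half V E) (c : ℝ) (e : E) (a : ℝ) : ℝ :=
  c * (a - H.cellL e) + H'.off (H.B.r e)

namespace IsShift

variable (h : IsShift H H' c)
include h

theorem lev_zero (he : H.B.lev (H.B.s e) = 0) : H'.B.lev (H.B.r e) = 0 := by
  have := h.lev (H.B.r e)
  have := H.B.lev_r e
  omega

theorem isPath_cons (he : H.B.lev (H.B.s e) = 0) (hf : p.first = H.B.r e)
    (hp : H'.B.IsPath p v) : H.B.IsPath (p.cons H.B.s e) v := by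
  induction p generalizing v with
  | start u => exact ⟨⟨rfl, he⟩, hf.symm.trans hp.1⟩
  | snoc p g ih =>
    refine ⟨ih hf ?_, ?_⟩
    · rw [← h.s]; exact hp.1
    · rw [← h.r]; exact hp.2

theorem exists_cons (hp : H.B.IsPath p v) (hv : 0 < H.B.lev v) :
    ∃ e q, p = q.cons H.B.s e ∧ H.B.lev (H.B.s e) = 0 ∧ q.first = H.B.r e ∧ H'.B.IsPath q v := by
  induction p generalizing v with
  | start u => have := hp.2; omega
  | snoc p e ih =>
    by_cases h0 : 0 < H.B.lev (H.B.s e)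
    · obtain ⟨g, q, rfl, h1, h2, h3⟩ := ih hp.1 h0
      refine ⟨g, .snoc q e, rfl, h1, h2, ?_, ?_⟩
      · rw [h.s]; exact h3
      · rw [h.r]; exact hp.2
    · have h1 := BiBratteli.IsPath.lev_nonneg hp.1
      have h2 : H.B.lev (H.B.s e) = 0 := by omega
      cases p with
      | start u =>
        obtain ⟨⟨rfl, -⟩, rfl⟩ := hp
        exact ⟨e, .start (H.B.r e), rfl, h2, rfl, rfl, h.lev_zero h2⟩
      | snoc p g =>
        have h3 := BiBratteli.IsPath.lev_nonneg hp.1.1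
        have h4 := H.B.lev_r g
        rw [hp.1.2] at h4
        omega

theorem exists_edge_first (hp : H'.B.IsPath p v) :
    ∃ e, H.B.lev (H.B.s e) = 0 ∧ p.first = H.B.r e := by
  have h0 := lev_first hp
  obtain ⟨e, he⟩ := H.B.exists_in p.first
  have h1 := H.B.lev_r e
  rw [h.lev] at h0
  rw [he] at h1
  exact ⟨e, by omega, he.symm⟩

theorem path_cons (he : H.B.lev (H.B.s e) = 0) (hf : p.first = H.B.r e)
    (hp : H'.B.IsPath p v) : H'.w.path p = c * H.w.path (p.cons H.B.s e) := by
  induction p generalizing v with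
  | start u =>
    rw [show u = H.B.r e from hf]
    exact h.vert e he
  | snoc p g ih =>
    have h1 := BiBratteli.IsPath.lev_nonneg hp.1
    rw [h.lev, h.s] at h1
    show H'.w.path p * H'.w.edge g = c * (H.w.path (p.cons H.B.s e) * H.w.edge g)
    rw [ih hf hp.1, h.edge g (by omega), mul_assoc]

theorem left_cons (he : H.B.lev (H.B.s e) = 0) (hf : p.first = H.B.r e)
    (hp : H'.B.IsPath p v) :
    H'.B.left H'.w p = move H H' c e (H.B.left H.w (p.cons H.B.s e)) := by
  induction p generalizing v with
  | start u =>
    have : move H H' c e (H.cellL e) = H'.off (H.B.r e) := by simp [move]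
    rw [show u = H.B.r e from hf]
    exact this.symm
  | snoc p g ih =>
    have h1 := BiBratteli.IsPath.lev_nonneg hp.1
    rw [h.lev, h.s] at h1
    have h2 : below H'.B.leS H'.w.edge g = below H.B.leS H.w.edge g := by
      rw [h.leS]
      refine finsum_mem_congr rfl fun x hx => h.edge x ?_
      rw [H.B.fiberS.proj_eq hx.1]
      omega
    show H'.B.left H'.w p + H'.w.path p * below H'.B.leS H'.w.edge g =
      move H H' c e (H.B.left H.w (p.cons H.B.s e) +
        H.w.path (p.cons H.B.s e) * below H.B.leS H.w.edge g)
    rw [ih hf hp.1, h2, h.path_cons (p := p) he hf hp.1, move, move]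
    ring

/-- The levels of the columns of the shift are the images of the levels of the next stage. -/
theorem move_mem_level (he : H.B.lev (H.B.s e) = 0) (hf : p.first = H.B.r e)
    (hp : H'.B.IsPath p v) :
    move H H' c e a ∈ H'.B.level H'.w p ↔ a ∈ H.B.level H.w (p.cons H.B.s e) := by
  have hc := h.pos
  rw [OrderedBratteli.level, OrderedBratteli.level, h.left_cons he hf hp, h.path_cons he hf hp,
    Set.mem_Ioo, Set.mem_Ioo, move, move]
  refine and_congr ?_ ?_
  · rw [add_lt_add_iff_right, mul_lt_mul_iff_right₀ hc, sub_lt_sub_iff_right]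
  · rw [add_right_comm, add_lt_add_iff_right, ← mul_add, mul_lt_mul_iff_right₀ hc, sub_add_eq_add_sub,
      sub_lt_sub_iff_right]

theorem pathLt_cons (hp : H'.B.IsPath p v) (hq : H'.B.IsPath q v) :
    H.B.pathLt (p.cons H.B.s e) (q.cons H.B.s f) ↔ H'.B.pathLt p q ∨ (p = q ∧ H.B.ltR e f) := by
  induction p generalizing q v with
  | start u =>
    cases q with
    | start u' =>
      have : u = u' := hp.1.trans hq.1.symm
      subst this
      simp [FinPath.cons, OrderedBratteli.pathLt]
    | snoc q g =>
      have h1 := BiBratteli.IsPath.lev_nonneg hq.1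
      have h2 := H'.B.lev_r g
      rw [hq.2, hp.2] at h2
      omega
  | snoc p g ih =>
    cases q with
    | start u =>
      have h1 := BiBratteli.IsPath.lev_nonneg hp.1
      have h2 := H'.B.lev_r g
      rw [hp.2, hq.2] at h2
      omega
    | snoc q k =>
      have hR : H'.B.ltR g k ↔ H.B.ltR g k := by
        rw [OrderedBratteli.ltR, OrderedBratteli.ltR, h.leR]
      simp only [FinPath.cons, OrderedBratteli.pathLt, FinPath.snoc.injEq, hR]
      by_cases hgk : g = k
      · subst hgk
        rw [ih hp.1 hq.1]
        tauto
      · tauto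

theorem isNext_cons (he : H.B.lev (H.B.s e) = 0) (hf : H.B.lev (H.B.s f) = 0)
    (hp : H'.B.IsPath p v) (hq : H'.B.IsPath q v) (hpe : p.first = H.B.r e)
    (hqf : q.first = H.B.r f) :
    H.B.IsNext v (p.cons H.B.s e) (q.cons H.B.s f) ↔
      (p = q ∧ Consec H.B.leR e f) ∨
      (IsFiberMax H.B.leR H.B.r e ∧ IsFiberMin H.B.leR H.B.r f ∧ H'.B.IsNext v p q) := by
  have hv : 0 < H.B.lev v := by
    have h1 := BiBratteli.IsPath.lev_nonneg hp
    rw [h.lev] at h1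
    omega
  have hRl := H.B.fiberR
  constructor
  · rintro ⟨h1, h2, h3, h4⟩
    rw [h.pathLt_cons hp hq] at h3
    rcases h3 with h3 | ⟨rfl, h3⟩
    · right
      refine ⟨?_, ?_, hp, hq, h3, fun z hz ⟨h5, h6⟩ => ?_⟩
      · refine (hRl.max_or_consec e).resolve_right ?_
        rintro ⟨g, hg⟩
        have hr := hRl.proj_eq hg.1.1
        have hg0 := (lev_source_eq hr).symm.trans he
        refine h4 (p.cons H.B.s g) (h.isPath_cons hg0 (hpe.trans hr) hp) ⟨?_, ?_⟩
        · exact (h.pathLt_cons hp hp).2 (Or.inr ⟨rfl, hg.1⟩)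
        · exact (h.pathLt_cons hp hq).2 (Or.inl h3)
      · refine (hRl.min_or_consec f).resolve_right ?_
        rintro ⟨g, hg⟩
        have hr := hRl.proj_eq hg.1.1
        have hg0 := (lev_source_eq hr).trans hf
        refine h4 (q.cons H.B.s g) (h.isPath_cons hg0 (hqf.trans hr.symm) hq) ⟨?_, ?_⟩
        · exact (h.pathLt_cons hp hq).2 (Or.inl h3)
        · exact (h.pathLt_cons hq hq).2 (Or.inr ⟨rfl, hg.1⟩)
      · obtain ⟨g, hg, hgz⟩ := h.exists_edge_first hz
        exact h4 (z.cons H.B.s g) (h.isPath_cons hg hgz hz)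
          ⟨(h.pathLt_cons hp hz).2 (Or.inl h5), (h.pathLt_cons hz hq).2 (Or.inl h6)⟩
    · left
      refine ⟨rfl, h3, fun g ⟨h5, h6⟩ => ?_⟩
      have hr := hRl.proj_eq h5.1
      have hg0 := (lev_source_eq hr).symm.trans he
      exact h4 (p.cons H.B.s g) (h.isPath_cons hg0 (hpe.trans hr) hp)
        ⟨(h.pathLt_cons hp hp).2 (Or.inr ⟨rfl, h5⟩), (h.pathLt_cons hp hp).2 (Or.inr ⟨rfl, h6⟩)⟩
  · intro h1
    refine ⟨h.isPath_cons he hpe hp, h.isPath_cons hf hqf hq, ?_, ?_⟩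
    · rw [h.pathLt_cons hp hq]
      rcases h1 with h1 | h1
      · exact Or.inr ⟨h1.1, h1.2.1⟩
      · exact Or.inl h1.2.2.2.2.1
    · rintro z hz ⟨h2, h3⟩
      obtain ⟨g, z, rfl, hg, hgz, hz'⟩ := h.exists_cons hz hv
      rw [h.pathLt_cons hp hz'] at h2
      rw [h.pathLt_cons hz' hq] at h3
      rcases h1 with ⟨rfl, h1⟩ | ⟨hmax, hmin, h1⟩
      · rcases h2 with h2 | ⟨rfl, h2⟩
        · rcases h3 with h3 | ⟨rfl, h3⟩
          · exact pathLt_asymm h2 h3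
          · exact pathLt_asymm h2 h2
        · rcases h3 with h3 | ⟨-, h3⟩
          · exact pathLt_asymm h3 h3
          · exact h1.2 g ⟨h2, h3⟩
      · rcases h2 with h2 | ⟨rfl, h2⟩
        · rcases h3 with h3 | ⟨rfl, h3⟩
          · exact h1.2.2.2 z hz' ⟨h2, h3⟩
          · exact h3.2 (hRl.antisymm _ _ h3.1 (hmin g (hRl.proj_eq h3.1)))
        · exact h2.2 (hRl.antisymm _ _ h2.1 (hmax g (hRl.proj_eq h2.1).symm))

end IsShift

end Half

/-! ### Dropping the first stage of a cutting and stacking map -/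

namespace Half

variable {H H' : Half V E} {c : ℝ} {a b : ℝ} {u v : V} {e f : E} {p q : FinPath V E} {x y : ℕ → E}

theorem level_subset_side (hp : H.B.IsPath p v) : H.B.level H.w p ⊆ H.side p.first := by
  induction p generalizing v with
  | start u => exact subset_rfl
  | snoc p e ih => exact (level_snoc_subset hp.1).trans (ih hp.1)

theorem level_initial_antitone (hx : x ∈ H.B.pathSpace) :
    Antitone fun n => H.B.level H.w (H.B.initial x n) :=
  antitone_nat_of_succ_le fun n => level_snoc_subset (BiBratteli.initial_isPath hx n)

theorem cell_subset_side (he : H.B.lev (H.B.s e) = 0) : H.cell e ⊆ H.side (H.B.s e) :=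
  level_snoc_subset (H := H) (p := .start (H.B.s e)) ⟨rfl, he⟩

theorem mem_level_of_translate (hp : H.B.IsPath p v) (hq : H.B.IsPath q v)
    (ha : a ∈ H.B.level H.w p) : a - H.B.left H.w p + H.B.left H.w q ∈ H.B.level H.w q := by
  have h1 := H.isWeight.path_eq v p q hp hq
  obtain ⟨h2, h3⟩ := ha
  constructor <;> linarith

theorem initial_succ (H H' : Half V E) (x : ℕ → E) (n : ℕ) :
    H.B.initial x (n + 1) = (H'.B.initial (fun n => x (n + 1)) n).cons H.B.s (x 0) := by
  induction n with
  | zero => rfl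
  | succ n ih =>
    show FinPath.snoc (H.B.initial x (n + 1)) (x (n + 1)) = _
    rw [ih]
    rfl

namespace IsShift

variable (h : IsShift H H' c)
include h

theorem exists_homeomorph_move (e : E) : ∃ φ : ℝ ≃ₜ ℝ, ∀ a, φ a = move H H' c e a :=
  ⟨((Homeomorph.addRight (-H.cellL e)).trans (Homeomorph.mulLeft₀ c h.pos.ne')).trans
    (Homeomorph.addRight (H'.off (H.B.r e))), fun a => by simp [move, sub_eq_add_neg]⟩

theorem move_injective (e : E) : Function.Injective (move H H' c e) := by
  obtain ⟨φ, hφ⟩ := h.exists_homeomorph_move e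
  rw [← funext hφ]
  exact φ.injective

theorem move_surjective (e : E) : Function.Surjective (move H H' c e) := by
  obtain ⟨φ, hφ⟩ := h.exists_homeomorph_move e
  rw [← funext hφ]
  exact φ.surjective

theorem level_cons_subset_cell (he : H.B.lev (H.B.s e) = 0) (hf : p.first = H.B.r e)
    (hp : H'.B.IsPath p v) : H.B.level H.w (p.cons H.B.s e) ⊆ H.cell e := by
  intro a ha
  have h1 := level_subset_side hp ((h.move_mem_level he hf hp).2 ha)
  rw [hf] at h1
  exact (h.move_mem_level (p := .start (H.B.r e)) he rfl ⟨rfl, h.lev_zero he⟩).1 h1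

theorem move_mem_side (he : H.B.lev (H.B.s e) = 0) :
    move H H' c e a ∈ H'.side (H.B.r e) ↔ a ∈ H.cell e :=
  h.move_mem_level (p := .start (H.B.r e)) he rfl ⟨rfl, h.lev_zero he⟩

theorem mem_pathSpace : x ∈ H.B.pathSpace ↔ H.B.lev (H.B.s (x 0)) = 0 ∧
    H.B.r (x 0) = H.B.s (x 1) ∧ (fun n => x (n + 1)) ∈ H'.B.pathSpace := by
  have h1 := H.B.lev_r (x 0)
  constructor
  · rintro ⟨h2, h3⟩
    refine ⟨h2, h3 0, ?_, fun n => ?_⟩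
    · show H'.B.lev (H'.B.s (x 1)) = 0
      rw [h.s, h.lev, ← h3 0]
      omega
    · rw [h.r, h.s]
      exact h3 (n + 1)
  · rintro ⟨h2, h3, h4⟩
    refine ⟨h2, ?_⟩
    rintro (_ | n)
    · exact h3
    · have := h4.2 n
      rwa [h.r, h.s] at this

theorem mem_tailClass (hy : y ∈ H.B.pathSpace) :
    y ∈ H.B.tailClass x ↔ (fun n => y (n + 1)) ∈ H'.B.tailClass fun n => x (n + 1) := by
  constructor
  · rintro ⟨-, N, hN⟩
    exact ⟨(h.mem_pathSpace.1 hy).2.2, N, fun k hk => hN (k + 1) (by omega)⟩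
  · rintro ⟨-, N, hN⟩
    refine ⟨hy, N + 1, ?_⟩
    rintro (_ | k) hk
    · omega
    · exact hN k (by omega)

theorem exists_extend (hy : y ∈ H'.B.pathSpace) :
    ∃ z ∈ H.B.pathSpace, (fun n => z (n + 1)) = y := by
  obtain ⟨e, he⟩ := H.B.exists_in (H.B.s (y 0))
  refine ⟨fun n => Nat.casesOn n e y, h.mem_pathSpace.2 ⟨?_, he, hy⟩, rfl⟩
  have h0 := hy.1
  have h1 := H.B.lev_r e
  rw [h.s, h.lev] at h0
  rw [he] at h1
  show H.B.lev (H.B.s e) = 0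
  omega

theorem finite_tailClass :
    (H.B.tailClass x).Finite ↔ (H'.B.tailClass fun n => x (n + 1)).Finite := by
  constructor
  · intro hfin
    refine (hfin.image fun y n => y (n + 1)).subset fun y hy => ?_
    obtain ⟨z, hz, rfl⟩ := h.exists_extend hy.1
    exact ⟨z, (h.mem_tailClass hz).2 hy, rfl⟩
  · intro hfin
    refine ((((H.B.finite_edges 0).prod hfin).image
      fun t : E × (ℕ → E) => (fun n => Nat.casesOn n t.1 t.2 : ℕ → E))).subset fun y hy => ?_
    refine ⟨(y 0, fun n => y (n + 1)), ⟨hy.1.1, (h.mem_tailClass hy.1).1 hy⟩, ?_⟩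
    funext n
    cases n <;> rfl

theorem isMaxPath (hx : x ∈ H.B.pathSpace) : H.B.IsMaxPath x ↔
    IsFiberMax H.B.leR H.B.r (x 0) ∧ H'.B.IsMaxPath fun n => x (n + 1) := by
  have h1 := (h.mem_pathSpace.1 hx).2.2
  rw [OrderedBratteli.IsMaxPath, OrderedBratteli.IsMaxPath, h.r, h.leR]
  refine ⟨fun h2 => ⟨h2.2 0, h1, fun n => h2.2 (n + 1)⟩, fun h2 => ⟨hx, ?_⟩⟩
  rintro (_ | n)
  · exact h2.1
  · exact h2.2.2 n

theorem isMinPath (hx : x ∈ H.B.pathSpace) : H.B.IsMinPath x ↔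
    IsFiberMin H.B.leR H.B.r (x 0) ∧ H'.B.IsMinPath fun n => x (n + 1) := by
  have h1 := (h.mem_pathSpace.1 hx).2.2
  rw [OrderedBratteli.IsMinPath, OrderedBratteli.IsMinPath, h.r, h.leR]
  refine ⟨fun h2 => ⟨h2.2 0, h1, fun n => h2.2 (n + 1)⟩, fun h2 => ⟨hx, ?_⟩⟩
  rintro (_ | n)
  · exact h2.1
  · exact h2.2.2 n

theorem initial_first (hx : x ∈ H.B.pathSpace) (n : ℕ) :
    (H'.B.initial (fun n => x (n + 1)) n).first = H.B.r (x 0) := by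
  induction n with
  | zero =>
    show H'.B.s (x 1) = _
    rw [h.s, hx.2 0]
  | succ n ih => exact ih

/-- The intersection of the levels of a path is not changed by dropping the first one, as the levels
are nested. -/
theorem mem_interior_level (hx : x ∈ H.B.pathSpace) :
    a ∈ interior (⋂ n, H.B.level H.w (H.B.initial x n)) ↔
      move H H' c (x 0) a ∈
        interior (⋂ n, H'.B.level H'.w (H'.B.initial (fun n => x (n + 1)) n)) := by
  obtain ⟨φ, hφ⟩ := h.exists_homeomorph_move (x 0)
  have key : ⋂ n, H.B.level H.w (H.B.initial x n) =
      φ ⁻¹' ⋂ n, H'.B.level H'.w (H'.B.initial (fun n => x (n + 1)) n) := by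
    obtain ⟨h0, -, h1⟩ := h.mem_pathSpace.1 hx
    ext b
    have h2 : ∀ n, φ b ∈ H'.B.level H'.w (H'.B.initial (fun n => x (n + 1)) n) ↔
        b ∈ H.B.level H.w (H.B.initial x (n + 1)) := fun n => by
      rw [hφ, initial_succ H H' x n]
      exact h.move_mem_level h0 (h.initial_first hx n) (BiBratteli.initial_isPath h1 n)
    simp only [Set.mem_iInter, Set.mem_preimage, h2]
    exact ⟨fun h3 n => h3 (n + 1), fun h3 n => level_initial_antitone hx n.le_succ (h3 n)⟩
  rw [key, ← φ.preimage_interior, Set.mem_preimage, hφ]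

theorem cellW_eq (he : H.B.lev (H.B.s e) = 0) (hr : H.B.r e = H.B.r f) :
    H.cellW e = H.cellW f := by
  have h1 := h.vert e he
  rw [hr, h.vert f ((lev_source_eq hr).symm.trans he)] at h1
  exact (mul_left_cancel₀ h.pos.ne' h1).symm

/-- A translation between the levels of two paths of `H` is conjugate to the translation between
the levels of the corresponding paths of the shift. -/
theorem translate_iff (he : H.B.lev (H.B.s e) = 0) (hf : H.B.lev (H.B.s f) = 0)
    (hpe : p.first = H.B.r e) (hqf : q.first = H.B.r f)
    (hp : H'.B.IsPath p u) (hq : H'.B.IsPath q v) :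
    b = a - H.B.left H.w (p.cons H.B.s e) + H.B.left H.w (q.cons H.B.s f) ↔
      move H H' c f b = move H H' c e a - H'.B.left H'.w p + H'.B.left H'.w q := by
  rw [h.left_cons he hpe hp, h.left_cons hf hqf hq]
  simp only [move]
  constructor
  · rintro rfl
    ring
  · intro h1
    refine mul_left_cancel₀ h.pos.ne' ?_
    linarith

/-- The cutting and stacking map of `H` in terms of that of its shift: it either moves a level of
stage `1` to the one above it in the same column, or it goes from the top level of a column of stage
`1` to the bottom level of another one and follows the map of the shift. -/
theorem T_iff : H.T a b ↔
    (∃ e f, H.B.lev (H.B.s e) = 0 ∧ Consec H.B.leR e f ∧ a ∈ H.cell e ∧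
      b = a - H.cellL e + H.cellL f) ∨
    (∃ e f, H.B.lev (H.B.s e) = 0 ∧ H.B.lev (H.B.s f) = 0 ∧ IsFiberMax H.B.leR H.B.r e ∧
      IsFiberMin H.B.leR H.B.r f ∧ a ∈ H.cell e ∧ b ∈ H.cell f ∧
      H'.T (move H H' c e a) (move H H' c f b)) := by
  constructor
  · rintro (⟨v, p, q, ha, hpq, hlev⟩ | ⟨x, y, _, _, hx, hy, hxy, hfin, ha, hb⟩)
    · have hv : 0 < H.B.lev v := by
        obtain ⟨h1, -, h2, -⟩ := hpq
        cases p with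
        | start u => exact h2.elim
        | snoc p e =>
          have h3 := BiBratteli.IsPath.lev_nonneg h1.1
          have h4 := H.B.lev_r e
          rw [h1.2] at h4
          omega
      obtain ⟨e, p, rfl, he, hpe, hp⟩ := h.exists_cons hpq.1 hv
      obtain ⟨f, q, rfl, hf, hqf, hq⟩ := h.exists_cons hpq.2.1 hv
      have hb := mem_level_of_translate hpq.1 hpq.2.1 hlev
      have hae := h.level_cons_subset_cell he hpe hp hlev
      rcases (h.isNext_cons he hf hp hq hpe hqf).1 hpq with ⟨rfl, h1⟩ | ⟨h1, h2, h3⟩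
      · refine Or.inl ⟨e, f, he, h1, hae, ?_⟩
        have hr : H.B.r e = H.B.r f := hpe.symm.trans hqf
        have h2 := h.left_cons he hpe hp
        have h3 := h.left_cons hf hqf hq
        rw [h2, move, move, hr, add_left_inj] at h3
        have := mul_left_cancel₀ h.pos.ne' h3
        linarith
      · refine Or.inr ⟨e, f, he, hf, h1, h2, hae, h.level_cons_subset_cell hf hqf hq hb, ?_⟩
        rw [(h.translate_iff he hf hpe hqf hp hq).1 rfl]
        exact .up v p q _ h3 ((h.move_mem_level he hpe hp).2 hlev)
    · have hxs := hx.1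
      have hys := hy.1
      obtain ⟨he, -, hx'⟩ := h.mem_pathSpace.1 hxs
      obtain ⟨hf, -, hy'⟩ := h.mem_pathSpace.1 hys
      have ha' := Set.mem_iInter.1 (interior_subset ha)
      refine Or.inr ⟨x 0, y 0, he, hf, hx.2 0, hy.2 0, ha' 1, ?_, ?_⟩
      · obtain ⟨N, hN⟩ := hxy.2
        obtain ⟨n, hn, hnN⟩ := (hb.and (eventually_gt_atTop N)).exists
        have h1 := BiBratteli.initial_isPath hxs n
        rw [hN n hnN] at h1
        have h2 := mem_level_of_translate h1 (BiBratteli.initial_isPath hys n) (ha' n)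
        rw [← hn] at h2
        exact level_initial_antitone hys (show 1 ≤ n by omega) h2
      · refine .periodic _ _ _ _ ((h.isMaxPath hxs).1 hx).2 ((h.isMinPath hys).1 hy).2
          ((h.mem_tailClass hys).1 hxy) (h.finite_tailClass.1 hfin)
          ((h.mem_interior_level hxs).1 ha) ?_
        filter_upwards [(tendsto_add_atTop_nat 1).eventually hb] with n hn
        rw [initial_succ H H' x, initial_succ H H' y] at hn
        exact (h.translate_iff he hf (h.initial_first hxs n) (h.initial_first hys n)
          (BiBratteli.initial_isPath hx' n) (BiBratteli.initial_isPath hy' n)).1 hn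
  · rintro (⟨e, f, he, hef, ha, rfl⟩ | ⟨e, f, he, hf, hmax, hmin, ha, hb, hT⟩)
    · have hr := H.B.fiberR.proj_eq hef.1.1
      have hf := (lev_source_eq hr).symm.trans he
      have hp : H'.B.IsPath (.start (H.B.r e)) (H.B.r e) := ⟨rfl, h.lev_zero he⟩
      exact .up (H.B.r e) (.snoc (.start (H.B.s e)) e) (.snoc (.start (H.B.s f)) f) a
        ((h.isNext_cons he hf hp hp rfl hr).2 (Or.inl ⟨rfl, hef⟩)) ha
    · have ha' := (h.move_mem_side he).2 ha
      have hb' := (h.move_mem_side hf).2 hb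
      have first_eq : ∀ {g : E} {z : FinPath V E} {v : V} {t : ℝ}, H.B.lev (H.B.s g) = 0 →
          H'.B.IsPath z v → t ∈ H'.B.level H'.w z → t ∈ H'.side (H.B.r g) →
          z.first = H.B.r g := by
        intro g z v t hg hz ht ht'
        have h1 : FinPath.start z.first = .start (H.B.r g) :=
          eq_of_mem_level (H := H') ⟨rfl, lev_first hz⟩ ⟨rfl, h.lev_zero hg⟩
            ((lev_first hz).trans (h.lev_zero hg).symm) (level_subset_side hz ht) ht'
        simpa using h1
      generalize hA : move H H' c e a = A at *
      generalize hB : move H H' c f b = B at *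
      rcases hT with ⟨v, p, q, _, hpq, hlev⟩ | ⟨x, y, _, _, hx, hy, hxy, hfin, hA', hB'⟩
      · have hp := hpq.1
        have hq := hpq.2.1
        have hpe := first_eq he hp hlev ha'
        have hqf := first_eq hf hq (mem_level_of_translate hp hq hlev) hb'
        subst hA
        rw [(h.translate_iff he hf hpe hqf hp hq).2 hB]
        exact .up v _ _ a ((h.isNext_cons he hf hp hq hpe hqf).2 (Or.inr ⟨hmax, hmin, hpq⟩))
          ((h.move_mem_level he hpe hp).1 hlev)
      · have hx0 := hx.1
        have hy0 := hy.1
        have hAx := Set.mem_iInter.1 (interior_subset hA')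
        have hxe : H.B.r e = H.B.s (x 0) := by
          have := first_eq he (BiBratteli.initial_isPath hx0 0) (hAx 0) ha'
          rw [← this, ← h.s]
          rfl
        have hyf : H.B.r f = H.B.s (y 0) := by
          obtain ⟨N, hN⟩ := hxy.2
          obtain ⟨n, hn, hnN⟩ := (hB'.and (eventually_gt_atTop N)).exists
          have h1 := BiBratteli.initial_isPath hx0 n
          rw [hN n hnN] at h1
          have h2 := mem_level_of_translate h1 (BiBratteli.initial_isPath hy0 n) (hAx n)
          rw [← hn] at h2
          have h3 := level_initial_antitone hy0 (show 0 ≤ n by omega) h2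
          have := first_eq hf (BiBratteli.initial_isPath hy0 0) h3 hb'
          rw [← this, ← h.s]
          rfl
        let X : ℕ → E := fun n => Nat.casesOn n e x
        let Y : ℕ → E := fun n => Nat.casesOn n f y
        have hX : X ∈ H.B.pathSpace := h.mem_pathSpace.2 ⟨he, hxe, hx0⟩
        have hY : Y ∈ H.B.pathSpace := h.mem_pathSpace.2 ⟨hf, hyf, hy0⟩
        refine .periodic X Y a b ((h.isMaxPath hX).2 ⟨hmax, hx⟩) ((h.isMinPath hY).2 ⟨hmin, hy⟩)
          ((h.mem_tailClass hY).2 hxy) (h.finite_tailClass.2 hfin)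
          ((h.mem_interior_level hX).2 ?_) ?_
        · show move H H' c e a ∈ _
          rw [hA]
          exact hA'
        · rw [← map_add_atTop_eq_nat 1, eventually_map]
          filter_upwards [hB'] with n hn
          rw [initial_succ H H' X, initial_succ H H' Y]
          refine (h.translate_iff he hf (h.initial_first hX n) (h.initial_first hY n)
            (BiBratteli.initial_isPath hx0 n) (BiBratteli.initial_isPath hy0 n)).2 ?_
          rw [hA, hB]
          exact hn

end IsShift

end Half

/-! ### The intervals of stages `0` and `1` -/

namespace Half

variable {H H' : Half V E} {c : ℝ} {a b : ℝ} {u v : V} {e f : E}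

/-- The closed interval over `v` of stage `0`. -/
noncomputable def closedSide (H : Half V E) (v : V) : Set ℝ :=
  Set.Icc (H.off v) (H.off v + H.w.vert v)

/-- The closed level of the edge `e` in its column of stage `1`. -/
noncomputable def closedCell (H : Half V E) (e : E) : Set ℝ :=
  Set.Icc (H.cellL e) (H.cellL e + H.cellW e)

theorem side_subset : H.side v ⊆ H.closedSide v := Set.Ioo_subset_Icc_self

theorem eq_of_mem_side (hu : H.B.lev u = 0) (hv : H.B.lev v = 0) (h1 : a ∈ H.side u)
    (h2 : a ∈ H.closedSide v) : u = v :=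
  H.B.fiberV.eq_of_below (hu.trans hv.symm) (vert_pos_of_level hv) h1.1 h1.2 h2.1 h2.2

theorem vert_pos (hv : H.B.lev v = 0) : 0 < H.w.vert v := H.isWeight.vert_pos v hv

theorem cellW_pos (he : H.B.lev (H.B.s e) = 0) : 0 < H.cellW e :=
  mul_pos (vert_pos he) (H.isWeight.edge_pos e he.ge)

theorem cellL_le_iff (he : H.B.lev (H.B.s e) = 0) :
    H.cellL e ≤ a ↔ below H.B.leS H.w.edge e ≤ (a - H.off (H.B.s e)) / H.w.vert (H.B.s e) := by
  rw [le_div_iff₀ (vert_pos he), cellL_eq, mul_comm, le_sub_iff_add_le']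

theorem le_cellR_iff (he : H.B.lev (H.B.s e) = 0) :
    a ≤ H.cellL e + H.cellW e ↔ (a - H.off (H.B.s e)) / H.w.vert (H.B.s e) ≤
      below H.B.leS H.w.edge e + H.w.edge e := by
  rw [div_le_iff₀ (vert_pos he), cellL_eq, cellW, sub_le_iff_le_add', add_mul, add_assoc,
    mul_comm (H.w.edge e), mul_comm (below _ _ _)]

theorem cellL_lt_iff (he : H.B.lev (H.B.s e) = 0) :
    H.cellL e < a ↔ below H.B.leS H.w.edge e < (a - H.off (H.B.s e)) / H.w.vert (H.B.s e) := by
  rw [lt_div_iff₀ (vert_pos he), cellL_eq, mul_comm, lt_sub_iff_add_lt']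

theorem lt_cellR_iff (he : H.B.lev (H.B.s e) = 0) :
    a < H.cellL e + H.cellW e ↔ (a - H.off (H.B.s e)) / H.w.vert (H.B.s e) <
      below H.B.leS H.w.edge e + H.w.edge e := by
  rw [div_lt_iff₀ (vert_pos he), cellL_eq, cellW, sub_lt_iff_lt_add', add_mul, add_assoc,
    mul_comm (H.w.edge e), mul_comm (below _ _ _)]

theorem off_le_cellL (he : H.B.lev (H.B.s e) = 0) : H.off (H.B.s e) ≤ H.cellL e := by
  rw [cellL_eq]
  have := mul_nonneg (vert_pos he).le (below_edge_nonneg he.ge)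
  linarith

theorem cellR_le (he : H.B.lev (H.B.s e) = 0) :
    H.cellL e + H.cellW e ≤ H.off (H.B.s e) + H.w.vert (H.B.s e) := by
  rw [cellL_eq, cellW]
  have := mul_le_mul_of_nonneg_left (below_edge_le he.ge) (vert_pos he).le
  linarith

theorem closedCell_subset (he : H.B.lev (H.B.s e) = 0) :
    H.closedCell e ⊆ H.closedSide (H.B.s e) :=
  Set.Icc_subset_Icc (off_le_cellL he) (cellR_le he)

theorem eq_of_mem_cell (he : H.B.lev (H.B.s e) = 0) (hf : H.B.lev (H.B.s f) = 0)
    (h1 : a ∈ H.cell e) (h2 : a ∈ H.closedCell f) : e = f := by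
  have hs := eq_of_mem_side he hf (cell_subset_side he h1) (closedCell_subset hf h2)
  have h3 := (cellL_le_iff hf).1 h2.1
  have h4 := (le_cellR_iff hf).1 h2.2
  rw [← hs] at h3 h4
  exact H.B.fiberS.eq_of_below hs (edge_pos_of_source hf.ge) ((cellL_lt_iff he).1 h1.1)
    ((lt_cellR_iff he).1 h1.2) h3 h4

theorem cellR_of_max (he : H.B.lev (H.B.s e) = 0) (hmax : IsFiberMax H.B.leS H.B.s e) :
    H.cellL e + H.cellW e = H.off (H.B.s e) + H.w.vert (H.B.s e) := by
  have := H.B.fiberS.below_max (w := H.w.edge) hmax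
  rw [H.isWeight.sum_out _ he.ge] at this
  rw [cellL_eq, cellW, add_assoc, ← mul_add, this, mul_one]

theorem cellL_of_min (hmin : IsFiberMin H.B.leS H.B.s e) : H.cellL e = H.off (H.B.s e) := by
  rw [cellL_eq, H.B.fiberS.below_min hmin, mul_zero, add_zero]

theorem max_of_cellR (he : H.B.lev (H.B.s e) = 0)
    (h : H.off (H.B.s e) + H.w.vert (H.B.s e) ≤ H.cellL e + H.cellW e) :
    IsFiberMax H.B.leS H.B.s e := by
  refine H.B.fiberS.max_of_below (edge_pos_of_source he.ge) ?_
  rw [H.isWeight.sum_out _ he.ge]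
  rwa [le_cellR_iff he, add_sub_cancel_left, div_self (vert_pos he).ne'] at h

theorem min_of_cellL (he : H.B.lev (H.B.s e) = 0) (h : H.cellL e ≤ H.off (H.B.s e)) :
    IsFiberMin H.B.leS H.B.s e := by
  refine H.B.fiberS.min_of_below (edge_pos_of_source he.ge) ?_
  rwa [cellL_le_iff he, sub_self, zero_div] at h

theorem cellL_of_consec (hef : Consec H.B.leS e f) : H.cellL f = H.cellL e + H.cellW e := by
  have hs := H.B.fiberS.proj_eq hef.1.1
  rw [cellL_eq, cellL_eq, cellW, H.B.fiberS.below_consec hef, hs, mul_add, add_assoc]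

theorem exists_mem_closedCell (hv : H.B.lev v = 0) (ha : a ∈ H.closedSide v) :
    ∃ e, H.B.s e = v ∧ a ∈ H.closedCell e := by
  obtain ⟨e₀, rfl⟩ := H.B.exists_out v
  have hp := vert_pos hv
  obtain ⟨e, he, h1, h2⟩ := H.B.fiberS.exists_below e₀ (w := H.w.edge)
    (edge_pos_of_source hv.ge) (y := (a - H.off (H.B.s e₀)) / H.w.vert (H.B.s e₀))
    (div_nonneg (sub_nonneg.2 ha.1) hp.le) (by
      rw [H.isWeight.sum_out _ hv.ge, div_le_one hp]
      linarith [ha.2])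
  rw [← he] at h1 h2 hv
  exact ⟨e, he, (cellL_le_iff hv).2 h1, (le_cellR_iff hv).2 h2⟩

theorem consec_of_mem_closedCell (he : H.B.lev (H.B.s e) = 0) (hs : H.B.s e = H.B.s f)
    (hne : e ≠ f) (h1 : a ∈ H.closedCell e) (h2 : a ∈ H.closedCell f) :
    (Consec H.B.leS e f ∧ a = H.cellL e + H.cellW e) ∨
      (Consec H.B.leS f e ∧ a = H.cellL f + H.cellW f) := by
  have hf := hs ▸ he
  have key : ∀ {e f : E}, H.B.lev (H.B.s e) = 0 → H.B.s e = H.B.s f → H.B.leS e f ∧ e ≠ f →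
      a ∈ H.closedCell e → a ∈ H.closedCell f →
      Consec H.B.leS e f ∧ a = H.cellL e + H.cellW e := by
    intro e f he hs hlt h1 h2
    have hf := hs ▸ he
    have h3 := (cellL_le_iff hf).1 h2.1
    rw [← hs] at h3
    have h4 := (H.B.fiberS.consec_of_below (edge_pos_of_source hf.ge) hlt
      ((le_cellR_iff he).1 h1.2) h3).1
    refine ⟨h4, le_antisymm h1.2 ?_⟩
    rw [← cellL_of_consec h4]
    exact h2.1
  exact (H.B.fiberS.trichotomy hs hne).imp (fun h => key he hs h h1 h2)
    fun h => key hf hs.symm h h2 h1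

theorem move_cellL : move H H' c e (H.cellL e) = H'.off (H.B.r e) := by
  simp [move]

namespace IsShift

variable (h : IsShift H H' c)
include h

theorem move_cellR (he : H.B.lev (H.B.s e) = 0) :
    move H H' c e (H.cellL e + H.cellW e) = H'.off (H.B.r e) + H'.w.vert (H.B.r e) := by
  rw [h.vert e he, move]
  ring

theorem move_mem_closedSide (he : H.B.lev (H.B.s e) = 0) :
    move H H' c e a ∈ H'.closedSide (H.B.r e) ↔ a ∈ H.closedCell e := by
  have hc := h.pos
  rw [closedSide, closedCell, Set.mem_Icc, Set.mem_Icc, h.vert e he, move]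
  refine and_congr ?_ ?_
  · rw [le_add_iff_nonneg_left, mul_nonneg_iff_of_pos_left hc, sub_nonneg]
  · rw [add_comm, add_le_add_iff_left, mul_le_mul_iff_right₀ hc, sub_le_iff_le_add']

end IsShift

/-! ### Surfaces glued from two halves -/

/-- The point `p` on the top side of a rectangle is glued to the point `q` on the bottom side of a
rectangle, for rectangles whose horizontal and vertical sides are the intervals of `X` and `Y`. -/
def VGlue (X Y : Half V E) (p q : ℝ × ℝ) : Prop :=
  ∃ u v, X.B.lev u = 0 ∧ X.B.lev v = 0 ∧ p.1 ∈ X.side u ∧ q.1 ∈ X.side v ∧ X.T p.1 q.1 ∧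
    p.2 = Y.off u + Y.w.vert u ∧ q.2 = Y.off v

/-- The gluing of the sides of the rectangles: tops to bottoms by the map of `X`, right sides to
left sides by the map of `Y`.  The definition is symmetric under exchanging `X` and `Y` together
with the coordinates. -/
def SGlue (X Y : Half V E) (p q : ℝ × ℝ) : Prop := VGlue X Y p q ∨ VGlue Y X p.swap q.swap

/-- The point lies in the interior of a rectangle. -/
def InRect (X Y : Half V E) (p : ℝ × ℝ) : Prop :=
  ∃ v, X.B.lev v = 0 ∧ p.1 ∈ X.side v ∧ p.2 ∈ Y.side v

/-- The point lies in the interior of a rectangle or takes part in a gluing. -/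
def InRegion (X Y : Half V E) (p : ℝ × ℝ) : Prop :=
  InRect X Y p ∨ ∃ q, SGlue X Y p q ∨ SGlue X Y q p

/-- The situation of a diagram and its shift: `X`, `Y` are the positive and the negative half of the
diagram, `X'`, `Y'` those of the shift, and `c` is the horizontal scaling factor.  Passing to the
shift drops a stage of the positive half and adds one to the negative half. -/
structure Renorm (X X' Y Y' : Half V E) (c : ℝ) : Prop where
  hX : IsShift X X' c
  hY : IsShift Y' Y c
  lev : ∀ v, Y.B.lev v = -X.B.lev v
  s : Y.B.s = X.B.r
  r : Y.B.r = X.B.s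
  leR : Y.B.leR = X.B.leS
  leS : Y.B.leS = X.B.leR

/-- The closed piece of the edge `e` contains `p`, and `q` is the new position of `p` when the
pieces are stretched by `c` horizontally, contracted by `c` vertically and stacked to towers.  The
vertical coordinate is described by the inverse map, which makes the relation symmetric under
`Renorm.swap`. -/
def Corr (X X' Y Y' : Half V E) (c : ℝ) (e : E) (p q : ℝ × ℝ) : Prop :=
  X.B.lev (X.B.s e) = 0 ∧ p.1 ∈ X.closedCell e ∧ q.1 = move X X' c e p.1 ∧
    q.2 ∈ Y'.closedCell e ∧ p.2 = move Y' Y c e q.2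

variable {X X' Y Y' : Half V E} {p q p₁ p₂ q₁ q₂ : ℝ × ℝ} {e₁ e₂ : E}

theorem sGlue_swap : SGlue Y X p.swap q.swap ↔ SGlue X Y p q := Or.comm

theorem eqvGen_swap (h : Relation.EqvGen (SGlue X Y) p q) :
    Relation.EqvGen (SGlue Y X) p.swap q.swap := by
  induction h with
  | rel p q h => exact .rel _ _ (sGlue_swap.2 h)
  | refl p => exact .refl _
  | symm p q _ ih => exact .symm _ _ ih
  | trans p q r _ _ ih1 ih2 => exact .trans _ _ _ ih1 ih2

theorem InRegion.left (h : SGlue X Y p q) : InRegion X Y p := Or.inr ⟨q, Or.inl h⟩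

theorem InRegion.right (h : SGlue X Y p q) : InRegion X Y q := Or.inr ⟨p, Or.inr h⟩

/-- Exchanging the coordinates turns the passage to the shift into its inverse. -/
theorem Renorm.swap (R : Renorm X X' Y Y' c) : Renorm Y' Y X' X c where
  hX := R.hY
  hY := R.hX
  lev v := by
    have h1 := R.hX.lev v
    have h2 := R.hY.lev v
    have h3 := R.lev v
    omega
  s := by rw [R.hX.s, ← R.hY.r, R.r]
  r := by rw [R.hX.r, ← R.hY.s, R.s]
  leR := by rw [R.hX.leR, ← R.hY.leS, R.leS]
  leS := by rw [R.hX.leS, ← R.hY.leR, R.leR]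

namespace Renorm

variable (R : Renorm X X' Y Y' c)
include R

theorem lev_zero (v : V) : Y.B.lev v = 0 ↔ X.B.lev v = 0 := by
  rw [R.lev, neg_eq_zero]

theorem s' : Y'.B.s = X.B.r := by rw [← R.hY.s, R.s]

theorem r' : Y'.B.r = X.B.s := by rw [← R.hY.r, R.r]

theorem leS' : Y'.B.leS = X.B.leR := by rw [← R.hY.leS, R.leS]

theorem leR' : Y'.B.leR = X.B.leS := by rw [← R.hY.leR, R.leR]

theorem lev_edge (he : X.B.lev (X.B.s e) = 0) : Y'.B.lev (Y'.B.s e) = 0 := by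
  have h1 := R.lev (X.B.r e)
  have h2 := R.hY.lev (X.B.r e)
  have h3 := X.B.lev_r e
  rw [R.s']
  omega

theorem lev_range (he : X.B.lev (X.B.s e) = 0) : X'.B.lev (X.B.r e) = 0 := R.hX.lev_zero he

theorem swap_corr : Corr Y' Y X' X c e q.swap p.swap ↔ Corr X X' Y Y' c e p q := by
  constructor
  · rintro ⟨h1, h2, h3, h4, h5⟩
    refine ⟨?_, h4, h5, h2, h3⟩
    have := R.swap.lev_edge h1
    exact this
  · rintro ⟨h1, h2, h3, h4, h5⟩
    exact ⟨R.lev_edge h1, h4, h5, h2, h3⟩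

theorem swap_inRect : InRect Y X p.swap ↔ InRect X Y p := by
  constructor <;> rintro ⟨v, h1, h2, h3⟩
  · exact ⟨v, (R.lev_zero v).1 h1, h3, h2⟩
  · exact ⟨v, (R.lev_zero v).2 h1, h3, h2⟩

theorem swap_inRegion : InRegion Y X p.swap ↔ InRegion X Y p := by
  refine or_congr R.swap_inRect ⟨?_, ?_⟩
  · rintro ⟨q, h⟩
    exact ⟨q.swap, h.imp sGlue_swap.1 sGlue_swap.1⟩
  · rintro ⟨q, h⟩
    exact ⟨q.swap, h.imp sGlue_swap.2 sGlue_swap.2⟩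

theorem snd_mem (h : Corr X X' Y Y' c e p q) : p.2 ∈ Y.closedSide (X.B.s e) := by
  obtain ⟨h1, h2, h3, h4, h5⟩ := h
  rw [h5, ← R.r']
  exact (R.hY.move_mem_closedSide (R.lev_edge h1)).2 h4

/-- The rectangle of a point of the region is determined even by the closed rectangles. -/
theorem exists_unique_rect (hp : InRegion X Y p) :
    ∃ u, X.B.lev u = 0 ∧ p.1 ∈ X.closedSide u ∧ p.2 ∈ Y.closedSide u ∧
      ∀ v, X.B.lev v = 0 → p.1 ∈ X.closedSide v → p.2 ∈ Y.closedSide v → v = u := by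
  have right_mem : ∀ {H : Half V E} {v : V}, H.B.lev v = 0 →
      H.off v + H.w.vert v ∈ H.closedSide v := fun hv =>
    ⟨by linarith [vert_pos hv], le_rfl⟩
  have left_mem : ∀ {H : Half V E} {v : V}, H.B.lev v = 0 → H.off v ∈ H.closedSide v := fun hv =>
    ⟨le_rfl, by linarith [vert_pos hv]⟩
  have horiz : ∀ {u : V}, X.B.lev u = 0 → p.1 ∈ X.side u → p.2 ∈ Y.closedSide u →
      ∃ u, X.B.lev u = 0 ∧ p.1 ∈ X.closedSide u ∧ p.2 ∈ Y.closedSide u ∧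
      ∀ v, X.B.lev v = 0 → p.1 ∈ X.closedSide v → p.2 ∈ Y.closedSide v → v = u :=
    fun {u} hu h1 h2 => ⟨u, hu, side_subset h1, h2,
      fun v hv h3 _ => (eq_of_mem_side hu hv h1 h3).symm⟩
  have vert : ∀ {u : V}, Y.B.lev u = 0 → p.1 ∈ X.closedSide u → p.2 ∈ Y.side u →
      ∃ u, X.B.lev u = 0 ∧ p.1 ∈ X.closedSide u ∧ p.2 ∈ Y.closedSide u ∧
      ∀ v, X.B.lev v = 0 → p.1 ∈ X.closedSide v → p.2 ∈ Y.closedSide v → v = u :=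
    fun {u} hu h1 h2 => ⟨u, (R.lev_zero u).1 hu, h1, side_subset h2,
      fun v hv _ h4 => (eq_of_mem_side hu ((R.lev_zero v).2 hv) h2 h4).symm⟩
  rcases hp with ⟨u, hu, h1, h2⟩ | ⟨q, (⟨u, v, hu, hv, h1, h2, h3, h4, h5⟩ |
    ⟨u, v, hu, hv, h1, h2, h3, h4, h5⟩) | (⟨u, v, hu, hv, h1, h2, h3, h4, h5⟩ |
    ⟨u, v, hu, hv, h1, h2, h3, h4, h5⟩)⟩
  · exact horiz hu h1 (side_subset h2)
  · exact horiz hu h1 (h4 ▸ right_mem ((R.lev_zero u).2 hu))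
  · exact vert hu (by rw [show p.1 = _ from h4]; exact right_mem ((R.lev_zero u).1 hu)) h1
  · exact horiz hv h2 (h5 ▸ left_mem ((R.lev_zero v).2 hv))
  · exact vert hv (by rw [show p.1 = _ from h5]; exact left_mem ((R.lev_zero v).1 hv)) h2

/-- Every point of the region lies in a piece. -/
theorem exists_corr (hp : InRegion X Y p) : ∃ e q, Corr X X' Y Y' c e p q := by
  obtain ⟨u, hu, h1, h2, -⟩ := R.exists_unique_rect hp
  obtain ⟨e, rfl, he⟩ := exists_mem_closedCell hu h1
  obtain ⟨y, hy⟩ := R.hY.move_surjective e p.2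
  refine ⟨e, (move X X' c e p.1, y), hu, he, rfl, ?_, hy.symm⟩
  rw [← R.hY.move_mem_closedSide (R.lev_edge hu), hy, R.r']
  exact h2

/-- A point of the region lies in pieces of one rectangle only. -/
theorem source_eq (hp : InRegion X Y p) (h1 : Corr X X' Y Y' c e₁ p q₁)
    (h2 : Corr X X' Y Y' c e₂ p q₂) : X.B.s e₁ = X.B.s e₂ := by
  obtain ⟨u, -, -, -, h3⟩ := R.exists_unique_rect hp
  rw [h3 _ h1.1 (closedCell_subset h1.1 h1.2.1) (R.snd_mem h1),
    h3 _ h2.1 (closedCell_subset h2.1 h2.2.1) (R.snd_mem h2)]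

theorem fst_mem_side_iff (h : Corr X X' Y Y' c e p q) :
    q.1 ∈ X'.side (X.B.r e) ↔ p.1 ∈ X.cell e := by
  rw [h.2.2.1]
  exact R.hX.move_mem_side h.1

theorem snd_mem_side_iff (h : Corr X X' Y Y' c e p q) :
    p.2 ∈ Y.side (X.B.s e) ↔ q.2 ∈ Y'.cell e := by
  rw [h.2.2.2.2, ← R.r']
  exact R.hY.move_mem_side (R.lev_edge h.1)

theorem snd_top_iff (h : Corr X X' Y Y' c e p q) :
    p.2 = Y.off (X.B.s e) + Y.w.vert (X.B.s e) ↔ q.2 = Y'.cellL e + Y'.cellW e := by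
  rw [h.2.2.2.2, ← R.r', ← R.hY.move_cellR (R.lev_edge h.1), (R.hY.move_injective e).eq_iff]

theorem snd_bot_iff (h : Corr X X' Y Y' c e p q) :
    p.2 = Y.off (X.B.s e) ↔ q.2 = Y'.cellL e := by
  rw [h.2.2.2.2, ← R.r', ← move_cellL, (R.hY.move_injective e).eq_iff]

theorem fst_right_iff (h : Corr X X' Y Y' c e p q) :
    q.1 = X'.off (X.B.r e) + X'.w.vert (X.B.r e) ↔ p.1 = X.cellL e + X.cellW e := by
  rw [h.2.2.1, ← R.hX.move_cellR h.1, (R.hX.move_injective e).eq_iff]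

theorem fst_left_iff (h : Corr X X' Y Y' c e p q) :
    q.1 = X'.off (X.B.r e) ↔ p.1 = X.cellL e := by
  rw [h.2.2.1, ← move_cellL, (R.hX.move_injective e).eq_iff]

/-- A top-to-bottom gluing stays one, or it becomes the interior of a tower where two pieces have
been stacked. -/
theorem vGlue_corr (hg : VGlue X Y p₁ p₂) (h1 : Corr X X' Y Y' c e₁ p₁ q₁)
    (h2 : Corr X X' Y Y' c e₂ p₂ q₂) : VGlue X' Y' q₁ q₂ ∨ (q₁ = q₂ ∧ InRect X' Y' q₁) := by
  obtain ⟨u, v, hu, hv, hpu, hpv, hT, htop, hbot⟩ := hg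
  obtain rfl := eq_of_mem_side hu h1.1 hpu (closedCell_subset h1.1 h1.2.1)
  obtain rfl := eq_of_mem_side hv h2.1 hpv (closedCell_subset h2.1 h2.2.1)
  rw [R.snd_top_iff h1] at htop
  rw [R.snd_bot_iff h2] at hbot
  rcases R.hX.T_iff.1 hT with ⟨e, f, he, hef, hpe, hp2⟩ | ⟨e, f, he, hf, hmax, hmin, hpe, hpf, hT'⟩
  · right
    have hr := X.B.fiberR.proj_eq hef.1.1
    have hf := (lev_source_eq hr).symm.trans he
    have hW := R.hX.cellW_eq he hr
    have hpf : p₂.1 ∈ X.cell f := by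
      obtain ⟨h3, h4⟩ := hpe
      constructor <;> linarith
    obtain rfl := eq_of_mem_cell he h1.1 hpe h1.2.1
    obtain rfl := eq_of_mem_cell hf h2.1 hpf h2.2.1
    have hef' : Consec Y'.B.leS e f := by rw [R.leS']; exact hef
    have hY := cellL_of_consec hef'
    have heq : q₁ = q₂ := by
      refine Prod.ext ?_ ?_
      · rw [h1.2.2.1, h2.2.2.1, move, move, hr, hp2]
        ring
      · rw [htop, hbot, hY]
    refine ⟨heq, X.B.r e, R.lev_range he, (R.fst_mem_side_iff h1).2 hpe, ?_⟩
    have h3 := R.lev_edge he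
    have h4 := R.lev_edge hf
    have h5 := cellR_le h4
    have h6 := off_le_cellL h3
    have h7 := cellW_pos h3
    have h8 := cellW_pos h4
    rw [R.s', ← hr] at h5
    rw [R.s'] at h6
    constructor <;> linarith
  · left
    obtain rfl := eq_of_mem_cell he h1.1 hpe h1.2.1
    obtain rfl := eq_of_mem_cell hf h2.1 hpf h2.2.1
    have hmax' : IsFiberMax Y'.B.leS Y'.B.s e := by rw [R.leS', R.s']; exact hmax
    have hmin' : IsFiberMin Y'.B.leS Y'.B.s f := by rw [R.leS', R.s']; exact hmin
    rw [cellR_of_max (R.lev_edge he) hmax', R.s'] at htop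
    rw [cellL_of_min hmin', R.s'] at hbot
    refine ⟨X.B.r e, X.B.r f, R.lev_range he, R.lev_range hf, (R.fst_mem_side_iff h1).2 hpe,
      (R.fst_mem_side_iff h2).2 hpf, ?_, htop, hbot⟩
    rw [h1.2.2.1, h2.2.2.1]
    exact hT'

/-- A right-to-left gluing stays one: it joins the last piece of a rectangle to the first piece of
another one. -/
theorem hGlue_corr (hg : VGlue Y X p₁.swap p₂.swap) (h1 : Corr X X' Y Y' c e₁ p₁ q₁)
    (h2 : Corr X X' Y Y' c e₂ p₂ q₂) : VGlue Y' X' q₁.swap q₂.swap := by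
  obtain ⟨u, v, hu, hv, hpu, hpv, hT, hright, hleft⟩ := hg
  obtain rfl := eq_of_mem_side hu ((R.lev_zero _).2 h1.1) hpu (R.snd_mem h1)
  obtain rfl := eq_of_mem_side hv ((R.lev_zero _).2 h2.1) hpv (R.snd_mem h2)
  simp only [Prod.fst_swap, Prod.snd_swap] at hpu hpv hT hright hleft
  have hr1 : p₁.1 = X.cellL e₁ + X.cellW e₁ :=
    le_antisymm h1.2.1.2 (hright ▸ cellR_le h1.1)
  have hl2 : p₂.1 = X.cellL e₂ := le_antisymm (hleft ▸ off_le_cellL h2.1) h2.2.1.1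
  have hmax : IsFiberMax Y'.B.leR Y'.B.r e₁ := by
    rw [R.leR', R.r']
    exact max_of_cellR h1.1 (by rw [← hright, hr1])
  have hmin : IsFiberMin Y'.B.leR Y'.B.r e₂ := by
    rw [R.leR', R.r']
    exact min_of_cellL h2.1 (by rw [← hleft, hl2])
  have hc1 := (R.snd_mem_side_iff h1).1 hpu
  have hc2 := (R.snd_mem_side_iff h2).1 hpv
  have hl1 := R.lev_edge h1.1
  have hl2' := R.lev_edge h2.1
  refine ⟨X.B.r e₁, X.B.r e₂, R.s' ▸ hl1, R.s' ▸ hl2', ?_, ?_, ?_, ?_, ?_⟩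
  · rw [← R.s']; exact cell_subset_side hl1 hc1
  · rw [← R.s']; exact cell_subset_side hl2' hc2
  · refine R.hY.T_iff.2 (Or.inr ⟨e₁, e₂, hl1, hl2', hmax, hmin, hc1, hc2, ?_⟩)
    simp only [Prod.fst_swap]
    rw [← h1.2.2.2.2, ← h2.2.2.2.2]
    exact hT
  · exact (R.fst_right_iff h1).2 hr1
  · exact (R.fst_left_iff h2).2 hl2

theorem sGlue_corr (hg : SGlue X Y p₁ p₂) (h1 : Corr X X' Y Y' c e₁ p₁ q₁)
    (h2 : Corr X X' Y Y' c e₂ p₂ q₂) : SGlue X' Y' q₁ q₂ ∨ (q₁ = q₂ ∧ InRect X' Y' q₁) :=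
  hg.elim (fun hg => (R.vGlue_corr hg h1 h2).imp_left Or.inl)
    fun hg => Or.inl (Or.inr (R.hGlue_corr hg h1 h2))

/-- The two sides of a cut are glued by the map of the new negative half. -/
theorem cut_corr (hc : Consec X.B.leS e₁ e₂) (hp : p.1 = X.cellL e₁ + X.cellW e₁)
    (hy : p.2 ∈ Y.side (X.B.s e₁)) (h1 : Corr X X' Y Y' c e₁ p q₁)
    (h2 : Corr X X' Y Y' c e₂ p q₂) : VGlue Y' X' q₁.swap q₂.swap := by
  have hs := X.B.fiberS.proj_eq hc.1.1
  have hc1 := (R.snd_mem_side_iff h1).1 hy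
  have hc2 := (R.snd_mem_side_iff h2).1 (hs ▸ hy)
  have hl1 := R.lev_edge h1.1
  have hl2 := R.lev_edge h2.1
  refine ⟨X.B.r e₁, X.B.r e₂, R.s' ▸ hl1, R.s' ▸ hl2, ?_, ?_, ?_, ?_, ?_⟩
  · rw [← R.s']; exact cell_subset_side hl1 hc1
  · rw [← R.s']; exact cell_subset_side hl2 hc2
  · refine R.hY.T_iff.2 (Or.inl ⟨e₁, e₂, hl1, by rw [R.leR']; exact hc, hc1, ?_⟩)
    have h3 := h1.2.2.2.2.symm.trans h2.2.2.2.2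
    rw [move, move, R.r', hs, add_left_inj] at h3
    have := mul_left_cancel₀ R.hY.pos.ne' h3
    simp only [Prod.fst_swap]
    linarith
  · exact (R.fst_right_iff h1).2 hp
  · exact (R.fst_left_iff h2).2 (hp.trans (cellL_of_consec hc).symm)

/-- The new positions of a point which lies in two pieces are glued. -/
theorem corr_corr (hp : InRegion X Y p) (h1 : Corr X X' Y Y' c e₁ p q₁)
    (h2 : Corr X X' Y Y' c e₂ p q₂) : q₁ = q₂ ∨ SGlue X' Y' q₁ q₂ ∨ SGlue X' Y' q₂ q₁ := by
  by_cases he : e₁ = e₂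
  · subst he
    refine Or.inl (Prod.ext (h1.2.2.1.trans h2.2.2.1.symm) ?_)
    exact R.hY.move_injective e₁ (h1.2.2.2.2.symm.trans h2.2.2.2.2)
  right
  have hs := R.source_eq hp h1 h2
  -- A point in two pieces is in no open level of stage `1`, so no top-to-bottom gluing applies.
  have hno : ∀ e, X.B.lev (X.B.s e) = 0 → p.1 ∉ X.cell e := fun e h3 h4 =>
    he ((eq_of_mem_cell h3 h1.1 h4 h1.2.1).symm.trans (eq_of_mem_cell h3 h2.1 h4 h2.2.1))
  have hside : p.2 ∈ Y.side (X.B.s e₁) := by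
    have fin : ∀ {u : V}, Y.B.lev u = 0 → p.2 ∈ Y.side u → p.2 ∈ Y.side (X.B.s e₁) := by
      intro u hu h3
      rwa [← eq_of_mem_side hu ((R.lev_zero _).2 h1.1) h3 (R.snd_mem h1)]
    rcases hp with ⟨u, hu, h3, h4⟩ | ⟨q, (⟨u, v, hu, hv, h3, h4, h5, h6, h7⟩ |
      ⟨u, v, hu, hv, h3, h4, h5, h6, h7⟩) | (⟨u, v, hu, hv, h3, h4, h5, h6, h7⟩ |
      ⟨u, v, hu, hv, h3, h4, h5, h6, h7⟩)⟩
    · exact fin ((R.lev_zero u).2 hu) h4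
    · rcases R.hX.T_iff.1 h5 with ⟨e, f, h8, -, h9, -⟩ | ⟨e, f, h8, -, -, -, h9, -⟩
      · exact (hno e h8 h9).elim
      · exact (hno e h8 h9).elim
    · exact fin hu h3
    · rcases R.hX.T_iff.1 h5 with ⟨e, f, h8, h9, h10, h11⟩ | ⟨e, f, -, h8, -, -, -, h9, -⟩
      · have hr := X.B.fiberR.proj_eq h9.1.1
        have hW := R.hX.cellW_eq h8 hr
        obtain ⟨h12, h13⟩ := h10
        exact (hno f ((lev_source_eq hr).symm.trans h8)
          ⟨by linarith, by linarith⟩).elim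
      · exact (hno f h8 h9).elim
    · exact fin hv h4
  rcases consec_of_mem_closedCell h1.1 hs he h1.2.1 h2.2.1 with ⟨h3, h4⟩ | ⟨h3, h4⟩
  · exact Or.inl (Or.inr (R.cut_corr h3 h4 hside h1 h2))
  · exact Or.inr (Or.inr (R.cut_corr h3 h4 (hs ▸ hside) h2 h1))

/-- New positions of points of the region are points of the new region. -/
theorem inRegion_corr (hp : InRegion X Y p) (h1 : Corr X X' Y Y' c e₁ p q₁) :
    InRegion X' Y' q₁ := by
  rcases hp with ⟨u, hu, h3, h4⟩ | ⟨p₂, hg | hg⟩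
  · have hp : InRegion X Y p := Or.inl ⟨u, hu, h3, h4⟩
    obtain rfl := eq_of_mem_side hu h1.1 h3 (closedCell_subset h1.1 h1.2.1)
    obtain ⟨h5, h6⟩ := h1.2.1
    -- The new position in a second piece of the same rectangle that contains `p`.
    have other : ∀ e, X.B.s e = X.B.s e₁ → p.1 ∈ X.closedCell e →
        ∃ q, Corr X X' Y Y' c e p q := by
      intro e hs hpe
      have he : X.B.lev (X.B.s e) = 0 := by rw [hs]; exact hu
      obtain ⟨y, hy⟩ := R.hY.move_surjective e p.2
      refine ⟨(move X X' c e p.1, y), he, hpe, rfl, ?_, hy.symm⟩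
      rw [← R.hY.move_mem_closedSide (R.lev_edge he), hy, R.r', hs]
      exact side_subset h4
    rcases h5.lt_or_eq with h5 | h5
    · rcases h6.lt_or_eq with h6 | h6
      · refine Or.inl ⟨X.B.r e₁, R.lev_range hu, (R.fst_mem_side_iff h1).2 ⟨h5, h6⟩, ?_⟩
        rw [← R.s']
        exact cell_subset_side (R.lev_edge hu) ((R.snd_mem_side_iff h1).1 h4)
      · rcases X.B.fiberS.max_or_consec e₁ with hmax | ⟨e, he⟩
        · exact absurd h3.2 (by rw [h6, cellR_of_max hu hmax]; exact lt_irrefl _)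
        · have hs := X.B.fiberS.proj_eq he.1.1
          have hl := cellL_of_consec he
          have hW := cellW_pos (H := X) (e := e) (hs ▸ hu)
          obtain ⟨q, hq⟩ := other e hs.symm ⟨by linarith, by linarith⟩
          exact InRegion.left (Or.inr (R.cut_corr he h6 h4 h1 hq))
    · rcases X.B.fiberS.min_or_consec e₁ with hmin | ⟨e, he⟩
      · exact absurd h3.1 (by rw [← h5, cellL_of_min hmin]; exact lt_irrefl _)
      · have hs := X.B.fiberS.proj_eq he.1.1
        have hl := cellL_of_consec he
        have hW := cellW_pos (H := X) (e := e) (hs ▸ hu)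
        obtain ⟨q, hq⟩ := other e hs ⟨by linarith, by linarith⟩
        exact InRegion.right (Or.inr (R.cut_corr he (by linarith) (hs ▸ h4) hq h1))
  · obtain ⟨e₂, q₂, h2⟩ := R.exists_corr (InRegion.right hg)
    rcases R.sGlue_corr hg h1 h2 with h3 | ⟨-, h3⟩
    · exact InRegion.left h3
    · exact Or.inl h3
  · obtain ⟨e₂, q₂, h2⟩ := R.exists_corr (InRegion.left hg)
    rcases R.sGlue_corr hg h2 h1 with h3 | ⟨h3, h4⟩
    · exact InRegion.right h3
    · exact Or.inl (h3 ▸ h4)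

/-- Points that represent the same point of the surface have new positions that represent the same
point of the new surface. -/
theorem eqvGen_corr (hg : Relation.EqvGen (SGlue X Y) p₁ p₂) (hp : InRegion X Y p₁)
    (h1 : Corr X X' Y Y' c e₁ p₁ q₁) (h2 : Corr X X' Y Y' c e₂ p₂ q₂) :
    Relation.EqvGen (SGlue X' Y') q₁ q₂ := by
  have hreg : ∀ {p q}, Relation.EqvGen (SGlue X Y) p q → (InRegion X Y p ↔ InRegion X Y q) := by
    intro p q h
    induction h with
    | rel p q h => exact ⟨fun _ => InRegion.right h, fun _ => InRegion.left h⟩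
    | refl p => exact Iff.rfl
    | symm p q _ ih => exact ih.symm
    | trans p q r _ _ ih1 ih2 => exact ih1.trans ih2
  induction hg generalizing e₁ e₂ q₁ q₂ with
  | rel p q h =>
    rcases R.sGlue_corr h h1 h2 with h3 | ⟨rfl, -⟩
    · exact .rel _ _ h3
    · exact .refl _
  | refl p =>
    rcases R.corr_corr hp h1 h2 with rfl | h3 | h3
    · exact .refl _
    · exact .rel _ _ h3
    · exact .symm _ _ (.rel _ _ h3)
  | symm p q h ih => exact .symm _ _ (ih ((hreg h).2 hp) h2 h1)
  | trans p q r h h' ih1 ih2 =>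
    have hq := (hreg h).1 hp
    obtain ⟨e, q', h3⟩ := R.exists_corr hq
    exact .trans _ _ _ (ih1 hp h1 h3) (ih2 hq h3 h2)

theorem inRegion_corr_iff (h : Corr X X' Y Y' c e p q) : InRegion X Y p ↔ InRegion X' Y' q := by
  refine ⟨fun hp => R.inRegion_corr hp h, fun hq => ?_⟩
  rw [← R.swap_inRegion]
  exact R.swap.inRegion_corr ((R.swap.swap_inRegion (p := q.swap)).1 hq) (R.swap_corr.2 h)

/-- Every point of the new region is the new position of a point of a piece. -/
theorem exists_corr_of_new (hq : InRegion X' Y' q) : ∃ e p, Corr X X' Y Y' c e p q := by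
  obtain ⟨e, p, h⟩ := R.swap.exists_corr ((R.swap.swap_inRegion (p := q.swap)).1 hq)
  exact ⟨e, p.swap, R.swap_corr.1 h⟩

theorem eqvGen_corr_iff (hp : InRegion X Y p₁) (h1 : Corr X X' Y Y' c e₁ p₁ q₁)
    (h2 : Corr X X' Y Y' c e₂ p₂ q₂) :
    Relation.EqvGen (SGlue X Y) p₁ p₂ ↔ Relation.EqvGen (SGlue X' Y') q₁ q₂ := by
  refine ⟨fun hg => R.eqvGen_corr hg hp h1 h2, fun hg => ?_⟩
  exact eqvGen_swap (R.swap.eqvGen_corr (eqvGen_swap hg)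
    ((R.swap.swap_inRegion (p := q₁.swap)).1 ((R.inRegion_corr_iff h1).1 hp)) (R.swap_corr.2 h1)
    (R.swap_corr.2 h2))

end Renorm

end Half

/-! ### Isomorphisms of glued surfaces that are defined piecewise -/

theorem diagMap_add (t : ℝ) (p q : ℝ × ℝ) : diagMap t (p + q) = diagMap t p + diagMap t q := by
  simp only [diagMap_apply]
  ext <;> simp [mul_add]

theorem diagMap_symm_add (t : ℝ) (p q : ℝ × ℝ) :
    (diagMap t).symm (p + q) = (diagMap t).symm p + (diagMap t).symm q := by
  rw [Homeomorph.symm_apply_eq, diagMap_add, Homeomorph.apply_symm_apply,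
    Homeomorph.apply_symm_apply]

theorem eq_transHomeomorph_symm_trans {X Y Z : Type*} [TopologicalSpace X] [TopologicalSpace Y]
    [TopologicalSpace Z] (φ : OpenPartialHomeomorph X Y) (d : Z ≃ₜ Y) :
    φ = (φ.transHomeomorph d.symm).transHomeomorph d := by
  ext x <;> simp

namespace PlanarGluing

variable {G G' : PlanarGluing} {ι : Type*} {K : ι → Set (ℝ × ℝ)} {Φ : ι → (ℝ × ℝ) ≃ₜ (ℝ × ℝ)}

/-- The region of `G` is cut into the closed pieces `K i`, and moving each piece by `Φ i` gives the
region of `G'`, in such a way that the identifications correspond to each other. -/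
structure PieceIso (G G' : PlanarGluing) {ι : Type*} (K : ι → Set (ℝ × ℝ))
    (Φ : ι → (ℝ × ℝ) ≃ₜ (ℝ × ℝ)) : Prop where
  closed : ∀ i, IsClosed (K i)
  cover : ∀ p ∈ G.region, ∃ i, p ∈ K i
  cover' : ∀ q ∈ G'.region, ∃ i, (Φ i).symm q ∈ K i
  region_iff : ∀ i, ∀ p ∈ K i, (p ∈ G.region ↔ Φ i p ∈ G'.region)
  rel_iff : ∀ i j, ∀ p ∈ K i, ∀ q ∈ K j, p ∈ G.region →
    (G.rel p q ↔ G'.rel (Φ i p) (Φ j q))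

namespace PieceIso

theorem symm (h : PieceIso G G' K Φ) :
    PieceIso G' G (fun i => (Φ i).symm ⁻¹' K i) fun i => (Φ i).symm where
  closed i := (h.closed i).preimage (Φ i).symm.continuous
  cover := h.cover'
  cover' p hp := by simpa using h.cover p hp
  region_iff i q hq := by simpa using (h.region_iff i _ hq).symm
  rel_iff i j p hp q hq hpr := by
    simpa using (h.rel_iff i j _ hp _ hq ((h.region_iff i _ hp).2 (by simpa using hpr))).symm

/-- The map of the surfaces that is given by `Φ i` on the piece `K i`.  It is continuous, as the
pieces are closed and finite in number. -/
theorem exists_map [Finite ι] (h : PieceIso G G' K Φ) :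
    ∃ F : G.Space → G'.Space, Continuous F ∧ ∀ (i : ι) (p : G.region), (p : ℝ × ℝ) ∈ K i →
      ∀ hp : Φ i p ∈ G'.region, F (G.proj p) = G'.proj ⟨Φ i p, hp⟩ := by
  choose idx hidx using fun p : G.region => h.cover p p.2
  have hmem : ∀ (i : ι) (p : G.region), (p : ℝ × ℝ) ∈ K i → Φ i p ∈ G'.region :=
    fun i p hp => (h.region_iff i p hp).1 p.2
  let f : G.region → G'.Space := fun p => G'.proj ⟨Φ (idx p) p, hmem _ p (hidx p)⟩
  have hrel : ∀ (i j : ι) (p q : G.region) (hp : (p : ℝ × ℝ) ∈ K i) (hq : (q : ℝ × ℝ) ∈ K j),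
      G.rel p q → G'.proj ⟨Φ i p, hmem i p hp⟩ = G'.proj ⟨Φ j q, hmem j q hq⟩ :=
    fun i j p q hp hq hpq => Quotient.sound ((h.rel_iff i j p hp q hq p.2).1 hpq)
  have hf : ∀ (i : ι) (p : G.region) (hp : (p : ℝ × ℝ) ∈ K i),
      f p = G'.proj ⟨Φ i p, hmem i p hp⟩ :=
    fun i p hp => hrel _ _ p p (hidx p) hp (G.rel.refl _)
  have hcont : Continuous f := by
    refine (locallyFinite_of_finite fun i => {p : G.region | (p : ℝ × ℝ) ∈ K i}).continuous
      (Set.iUnion_eq_univ_iff.2 fun p => ⟨idx p, hidx p⟩)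
      (fun i => (h.closed i).preimage continuous_subtype_val) fun i => ?_
    rw [continuousOn_iff_continuous_domRestrict]
    have : Set.domRestrict {p : G.region | (p : ℝ × ℝ) ∈ K i} f =
        fun p => G'.proj ⟨Φ i p.1, hmem i p.1 p.2⟩ := funext fun p => hf i p.1 p.2
    rw [this]
    refine continuous_quotient_mk'.comp (Continuous.subtype_mk ?_ _)
    exact (Φ i).continuous.comp (continuous_subtype_val.comp continuous_subtype_val)
  exact ⟨Quotient.lift f fun p q hpq => hrel _ _ p q (hidx p) (hidx q) hpq,
    hcont.quotient_lift _, fun i p hp _ => hf i p hp⟩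

/-- A function which is locally `M` up to a constant on the target of a piecewise map, whose pieces
move by `L` up to constants, is locally `M ∘ L` up to a constant on the source.  All pieces that
contain a point give the same constant, since they give the same value at that point. -/
theorem eventually_comp [Finite ι] (h : PieceIso G G' K Φ) {F : G.Space → G'.Space}
    (hF : ∀ (i : ι) (p : G.region), (p : ℝ × ℝ) ∈ K i →
      ∀ hp : Φ i p ∈ G'.region, F (G.proj p) = G'.proj ⟨Φ i p, hp⟩)
    {L M : ℝ × ℝ → ℝ × ℝ} (hL : ∀ i, ∃ k, ∀ p, Φ i p = L p + k)
    (hM : ∀ p q, M (p + q) = M p + M q) {g : G'.Space → ℝ × ℝ} {U : Set G'.Space}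
    (hg : ∀ q : G'.region, G'.proj q ∈ U →
      ∃ c : ℝ × ℝ, ∀ᶠ y : G'.region in 𝓝 q, g (G'.proj y) = M y + c)
    (p : G.region) (hp : F (G.proj p) ∈ U) :
    ∃ c : ℝ × ℝ, ∀ᶠ y : G.region in 𝓝 p, g (F (G.proj y)) = M (L y) + c := by
  refine ⟨g (F (G.proj p)) - M (L p), ?_⟩
  have key : ∀ i, ∀ᶠ y : G.region in 𝓝 p, (y : ℝ × ℝ) ∈ K i →
      g (F (G.proj y)) = M (L y) + (g (F (G.proj p)) - M (L p)) := by
    intro i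
    by_cases hi : (p : ℝ × ℝ) ∈ K i
    · have hq := (h.region_iff i p hi).1 p.2
      obtain ⟨k, hk⟩ := hL i
      have hFp := hF i p hi hq
      obtain ⟨c, hc⟩ := hg ⟨Φ i p, hq⟩ (hFp ▸ hp)
      have hval := hc.self_of_nhds
      rw [nhds_subtype_eq_comap, eventually_comap] at hc
      have ht : Tendsto (fun y : G.region => Φ i y) (𝓝 p) (𝓝 (Φ i p)) :=
        ((Φ i).continuous.comp continuous_subtype_val).continuousAt
      filter_upwards [ht.eventually hc] with y hy hyi
      have hyq := (h.region_iff i y hyi).1 y.2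
      rw [hF i y hyi hyq, hy ⟨Φ i y, hyq⟩ rfl, hFp, hval]
      simp only [hk, hM]
      abel
    · have hopen : IsOpen {y : G.region | (y : ℝ × ℝ) ∉ K i} :=
        (h.closed i).isOpen_compl.preimage continuous_subtype_val
      filter_upwards [hopen.mem_nhds hi] with y hy hyi
      exact (hy hyi).elim
  filter_upwards [eventually_all.2 key] with y hy
  obtain ⟨i, hi⟩ := h.cover y y.2
  exact hy i hi

/-- If all pieces are moved by `diagMap t` up to translations, the piecewise map is an isomorphism
from the surface deformed for time `t`. -/
theorem exists_isIso [Finite ι] (h : PieceIso G G' K Φ) (t : ℝ)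
    (hΦ : ∀ i, ∃ k, ∀ p, Φ i p = diagMap t p + k) :
    ∃ R : G.Space → G'.Space, (∀ (i : ι) (p : G.region), (p : ℝ × ℝ) ∈ K i →
      ∀ hp : Φ i p ∈ G'.region, R (G.proj p) = G'.proj ⟨Φ i p, hp⟩) ∧
      (G.surface.teich t).IsIso G'.surface R := by
  obtain ⟨R, hRc, hR⟩ := h.exists_map
  obtain ⟨Q, hQc, hQ⟩ := h.symm.exists_map
  have hQR : ∀ x, Q (R x) = x := by
    rintro ⟨p⟩
    obtain ⟨i, hi⟩ := h.cover p p.2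
    have hp := (h.region_iff i p hi).1 p.2
    change Q (R (G.proj p)) = G.proj p
    rw [hR i p hi hp, hQ i ⟨Φ i p, hp⟩ (by simpa using hi) (by simp)]
    congr 1
    exact Subtype.ext ((Φ i).symm_apply_apply p)
  have hRQ : ∀ x, R (Q x) = x := by
    rintro ⟨q⟩
    obtain ⟨i, hi⟩ := h.cover' q q.2
    have hq := (h.symm.region_iff i q hi).1 q.2
    change R (Q (G'.proj q)) = G'.proj q
    rw [hQ i q hi hq, hR i ⟨(Φ i).symm q, hq⟩ hi (by simp)]
    congr 1
    exact Subtype.ext ((Φ i).apply_symm_apply q)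
  have hΦ' : ∀ i, ∃ k, ∀ q, (Φ i).symm q = (diagMap t).symm q + k := by
    intro i
    obtain ⟨k, hk⟩ := hΦ i
    refine ⟨-(diagMap t).symm k, fun q => ?_⟩
    have h1 := diagMap_symm_add t (q - k) k
    rw [sub_add_cancel] at h1
    rw [Homeomorph.symm_apply_eq, hk, h1, add_neg_cancel_right, Homeomorph.apply_symm_apply,
      sub_add_cancel]
  refine ⟨R, hR, ⟨⟨R, Q, hQR, hRQ⟩, hRc, hQc⟩, fun _ => rfl, fun φ => ⟨fun hφ => ?_, ?_⟩⟩
  · refine ⟨(Homeomorph.transOpenPartialHomeomorph ⟨⟨R, Q, hQR, hRQ⟩, hRc, hQc⟩ φ).transHomeomorph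
      (diagMap t).symm, fun p hp => ?_, ?_⟩
    · obtain ⟨c, hc⟩ := h.eventually_comp hR (L := diagMap t) (M := id) hΦ (fun _ _ => rfl)
        (g := φ) (U := φ.source) hφ p hp
      refine ⟨(diagMap t).symm c, ?_⟩
      filter_upwards [hc] with y hy
      show (diagMap t).symm (φ (R (G.proj y))) = _
      rw [hy, diagMap_symm_add, id, Homeomorph.symm_apply_apply]
    · exact eq_transHomeomorph_symm_trans _ _
  · rintro ⟨ψ, hψ, hφψ⟩ q hq
    have hsrc : ∀ x, R x ∈ φ.source → x ∈ ψ.source := fun x hx => by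
      exact (Set.ext_iff.1 (congrArg
        (fun χ : OpenPartialHomeomorph G.Space (ℝ × ℝ) => χ.source) hφψ) x).1 hx
    have hval : ∀ x, φ (R x) = diagMap t (ψ x) := fun x =>
      congrArg (fun χ : OpenPartialHomeomorph G.Space (ℝ × ℝ) => χ x) hφψ
    obtain ⟨c, hc⟩ := h.symm.eventually_comp hQ (L := (diagMap t).symm) (M := diagMap t) hΦ'
      (diagMap_add t) (g := fun x => diagMap t (ψ x)) (U := ψ.source) (fun p hp => by
        obtain ⟨c, hc⟩ := hψ p hp
        refine ⟨diagMap t c, ?_⟩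
        filter_upwards [hc] with y hy
        exact (congrArg (diagMap t) hy).trans (diagMap_add t _ _)) q (hsrc _ (by rw [hRQ]; exact hq))
    refine ⟨c, ?_⟩
    filter_upwards [hc] with y hy
    rw [← hval, hRQ, Homeomorph.apply_symm_apply] at hy
    exact hy

end PieceIso

end PlanarGluing

/-! ### The surface of a diagram and of its shift -/

namespace Diagram

open Half

variable (D : Diagram V E) {e : E} {p q : ℝ × ℝ}

/-- The positive half of a diagram. -/
def pos : Half V E := ⟨D.toOrderedBratteli, D.wp, D.wp_isWeight⟩

/-- The negative half of a diagram, with all edges reversed. -/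
def neg : Half V E := ⟨D.toOrderedBratteli.rev, D.wm, D.wm_isWeight⟩

theorem renorm : Renorm D.pos D.shift.pos D.neg D.shift.neg (Real.exp D.time) where
  hX :=
    { lev := fun _ => rfl
      s := rfl
      r := rfl
      leR := rfl
      leS := rfl
      pos := Real.exp_pos _
      vert := fun e he => congrArg (Real.exp D.time * ·) (D.wp_isWeight.vertex_edge he)
      edge := fun _ _ => rfl }
  hY :=
    { lev := fun v => show -D.lev v = -(D.lev v - 1) - 1 by omega
      s := rfl
      r := rfl
      leR := rfl
      leS := rfl
      pos := Real.exp_pos _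
      vert := fun e he => by
        have he' : -(D.lev (D.r e) - 1) = 0 := he
        have hl := D.lev_r e
        have hh := D.height_pos (v := D.r e) (by omega)
        show D.wm.vert (D.s e) =
          Real.exp D.time * (Real.exp (-D.time) * D.height (D.r e) * D.shiftWm.edge e)
        rw [D.shiftWm_edge_zero (by omega), ← mul_assoc, ← mul_assoc, ← Real.exp_add,
          add_neg_cancel, Real.exp_zero, one_mul, mul_div_cancel₀ _ hh.ne']
      edge := fun e he => by
        have he' : 0 < -(D.lev (D.r e) - 1) := he
        have hl := D.lev_r e
        exact (D.shiftWm_edge_ne (by omega)).symm }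
  lev _ := rfl
  s := rfl
  r := rfl
  leR := rfl
  leS := rfl

theorem glue_iff : D.Glue p q ↔ SGlue D.pos D.neg p q := by
  have hlev : ∀ v, D.neg.B.lev v = 0 ↔ D.lev v = 0 := D.renorm.lev_zero
  constructor
  · rintro (⟨u, v, a, b, hu, hv, ha, hb, hab⟩ | ⟨u, v, a, b, hu, hv, ha, hb, hab⟩)
    · exact Or.inl ⟨u, v, hu, hv, ha, hb, hab, rfl, rfl⟩
    · exact Or.inr ⟨u, v, (hlev u).2 hu, (hlev v).2 hv, ha, hb, hab, rfl, rfl⟩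
  · obtain ⟨a, y⟩ := p
    obtain ⟨b, z⟩ := q
    rintro (⟨u, v, hu, hv, ha, hb, hab, rfl, rfl⟩ | ⟨u, v, hu, hv, ha, hb, hab, h1, h2⟩)
    · exact .vertical u v a b hu hv ha hb hab
    · simp only [Prod.snd_swap] at h1 h2
      subst h1 h2
      exact .horizontal u v y z ((hlev u).1 hu) ((hlev v).1 hv) ha hb hab

theorem mem_region : p ∈ D.gluing.region ↔ InRegion D.pos D.neg p := by
  refine or_congr ?_ ?_
  · simp only [Set.mem_iUnion, Set.mem_prod]
    exact ⟨fun ⟨v, hv, h⟩ => ⟨v, hv, h⟩, fun ⟨v, hv, h⟩ => ⟨v, hv, h⟩⟩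
  · exact exists_congr fun q => or_congr D.glue_iff D.glue_iff

theorem gluing_rel : D.gluing.rel p q ↔ Relation.EqvGen (SGlue D.pos D.neg) p q := by
  have : D.Glue = SGlue D.pos D.neg := by
    funext p q
    exact propext D.glue_iff
  rw [← this]
  rfl

/-- The pieces in a tower are stacked at the levels of stage `1` of the new negative half. -/
theorem corner_snd (he : D.lev (D.s e) = 0) : (D.corner e).2 = D.shift.neg.cellL e := by
  have hl := D.lev_r e
  have hh := D.height_pos (v := D.r e) (by omega)
  show _ + ∑ᶠ f ∈ {f | D.ltR f e}, Real.exp (-D.time) * D.wm.vert (D.s f) =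
    _ + Real.exp (-D.time) * D.height (D.r e) * ∑ᶠ f ∈ {f | D.ltR f e}, D.shiftWm.edge f
  rw [mul_finsum_mem]
  congr 1
  refine finsum_mem_congr rfl fun f hf => ?_
  have hr := D.fiberR.proj_eq hf.1
  have hl' := D.lev_r f
  rw [hr] at hl'
  rw [D.shiftWm_edge_zero (by omega), hr]
  field_simp

theorem place_fst (e : E) (p : ℝ × ℝ) :
    (D.place e p).1 = move D.pos D.shift.pos (Real.exp D.time) e p.1 := by
  show Real.exp D.time * p.1 + ((D.corner e).1 - Real.exp D.time * D.cutX e) =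
    Real.exp D.time * (p.1 - D.cutX e) + (D.corner e).1
  ring

/-- Vertically, the motion of a piece is inverse to the motion of a level of the longer negative half
onto an interval of the shorter one. -/
theorem place_snd (he : D.lev (D.s e) = 0) (p : ℝ × ℝ) :
    p.2 = move D.shift.neg D.neg (Real.exp D.time) e (D.place e p).2 := by
  show p.2 = Real.exp D.time * (Real.exp (-D.time) * p.2 + ((D.corner e).2 -
    Real.exp (-D.time) * D.offY (D.s e)) - D.shift.neg.cellL e) + D.offY (D.s e)
  rw [D.corner_snd he, Real.exp_neg]
  have := Real.exp_ne_zero D.time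
  field_simp
  ring

theorem corr_iff : Corr D.pos D.shift.pos D.neg D.shift.neg (Real.exp D.time) e p q ↔
    D.lev (D.s e) = 0 ∧ p ∈ D.piece e ∧ q = D.place e p := by
  refine and_congr_right fun he => ?_
  have hmem : (D.place e p).2 ∈ D.shift.neg.closedCell e ↔ p.2 ∈ D.neg.closedSide (D.s e) := by
    rw [D.place_snd he p]
    exact (D.renorm.hY.move_mem_closedSide (D.renorm.lev_edge he)).symm.trans (by
      rw [← D.place_snd he p]; rfl)
  constructor
  · rintro ⟨h1, h2, h3, h4⟩
    have hq : q = D.place e p := by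
      refine Prod.ext (h2.trans (D.place_fst e p).symm) ?_
      exact D.renorm.hY.move_injective e (h4.symm.trans (D.place_snd he p))
    subst hq
    exact ⟨⟨h1, hmem.1 h3⟩, rfl⟩
  · rintro ⟨⟨h1, h2⟩, rfl⟩
    exact ⟨h1, D.place_fst e p, hmem.2 h2, D.place_snd he p⟩

theorem exists_piece (hp : p ∈ D.gluing.region) : ∃ e, D.lev (D.s e) = 0 ∧ p ∈ D.piece e := by
  obtain ⟨e, q, h⟩ := D.renorm.exists_corr (D.mem_region.1 hp)
  rw [corr_iff] at h
  exact ⟨e, h.1, h.2.1⟩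

theorem exists_place (hq : q ∈ D.shift.gluing.region) :
    ∃ e p, D.lev (D.s e) = 0 ∧ p ∈ D.piece e ∧ q = D.place e p := by
  obtain ⟨e, p, h⟩ := D.renorm.exists_corr_of_new (D.shift.mem_region.1 hq)
  exact ⟨e, p, D.corr_iff.1 h⟩

theorem place_mem_region (he : D.lev (D.s e) = 0) (hp : p ∈ D.piece e) :
    p ∈ D.gluing.region ↔ D.place e p ∈ D.shift.gluing.region := by
  rw [mem_region, mem_region]
  exact D.renorm.inRegion_corr_iff (D.corr_iff.2 ⟨he, hp, rfl⟩)

theorem place_rel {e e' : E} {p p' : ℝ × ℝ} (he : D.lev (D.s e) = 0) (he' : D.lev (D.s e') = 0)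
    (hp : p ∈ D.piece e) (hp' : p' ∈ D.piece e') (hr : p ∈ D.gluing.region) :
    D.gluing.rel p p' ↔ D.shift.gluing.rel (D.place e p) (D.place e' p') := by
  rw [gluing_rel, gluing_rel]
  exact D.renorm.eqvGen_corr_iff (D.mem_region.1 hr) (D.corr_iff.2 ⟨he, hp, rfl⟩)
    (D.corr_iff.2 ⟨he', hp', rfl⟩)

/-- The shift has the same planar region with the same identifications as the deformed, cut and
stacked surface. -/
theorem shift_gluing : D.shift.gluing = D.cutStack := by
  have hreg : D.shift.gluing.region = D.cutStack.region := by
    ext q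
    constructor
    · intro hq
      obtain ⟨e, p, he, hp, rfl⟩ := D.exists_place hq
      exact ⟨e, he, p, ⟨(D.place_mem_region he hp).2 hq, hp⟩, rfl⟩
    · rintro ⟨e, he, p, ⟨hr, hp⟩, rfl⟩
      exact (D.place_mem_region he hp).1 hr
  have hrel : D.shift.gluing.rel = D.cutStack.rel := by
    refine Setoid.ext fun q q' => ⟨fun h => ?_, fun h => ?_⟩
    · refine Relation.EqvGen.mono (r := D.shift.Glue) (p := D.Moved) (fun q q' hg => ?_) q q' h
      have hq : q ∈ D.shift.gluing.region := Or.inr ⟨q', Or.inl hg⟩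
      have hq' : q' ∈ D.shift.gluing.region := Or.inr ⟨q, Or.inr hg⟩
      obtain ⟨e, p, he, hp, rfl⟩ := D.exists_place hq
      obtain ⟨e', p', he', hp', rfl⟩ := D.exists_place hq'
      have hr := (D.place_mem_region he hp).2 hq
      exact ⟨e, e', p, p', he, he', ⟨hr, hp⟩, ⟨(D.place_mem_region he' hp').2 hq', hp'⟩,
        (D.place_rel he he' hp hp' hr).2 (.rel _ _ hg), rfl, rfl⟩
    · change Relation.EqvGen D.Moved q q' at h
      induction h with
      | rel q q' h =>
        obtain ⟨e, e', p, p', he, he', ⟨hr, hp⟩, ⟨-, hp'⟩, hpp, rfl, rfl⟩ := h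
        exact (D.place_rel he he' hp hp' hr).1 hpp
      | refl q => exact Setoid.refl' _ q
      | symm q q' _ ih => exact Setoid.symm' _ ih
      | trans q q' q'' _ _ ih1 ih2 => exact Setoid.trans' _ ih1 ih2
  rw [show D.shift.gluing = ⟨D.shift.gluing.region, D.shift.gluing.rel⟩ from rfl, hreg, hrel]

/-- The motion of the piece of the edge `e` as a homeomorphism of the plane. -/
noncomputable def placeHomeomorph (e : E) : (ℝ × ℝ) ≃ₜ (ℝ × ℝ) :=
  (diagMap D.time).trans
    (Homeomorph.addRight (D.corner e - diagMap D.time (D.cutX e, D.offY (D.s e))))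

theorem pieceIso : PlanarGluing.PieceIso D.gluing D.cutStack
    (fun e : {e // D.lev (D.s e) = 0} => D.piece e) fun e => D.placeHomeomorph e where
  closed _ := isClosed_Icc.prod isClosed_Icc
  cover p hp := by
    obtain ⟨e, he, h⟩ := D.exists_piece hp
    exact ⟨⟨e, he⟩, h⟩
  cover' q hq := by
    obtain ⟨e, he, p, ⟨-, hp⟩, rfl⟩ := hq
    refine ⟨⟨e, he⟩, ?_⟩
    rwa [show D.place e p = D.placeHomeomorph e p from rfl, Homeomorph.symm_apply_apply]
  region_iff e p hp := by
    rw [← D.shift_gluing]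
    exact D.place_mem_region e.2 hp
  rel_iff e f p hp q hq hpr := by
    rw [← D.shift_gluing]
    exact D.place_rel e.2 f.2 hp hq hpr

end Diagram

end Bratteli

theorem proposition6p1 {V E : Type*} (D : Bratteli.Diagram V E) :
    D.shift.gluing = D.cutStack ∧
    ∃ R : D.gluing.Space → D.cutStack.Space,
      (D.IsRenormMap R ∧ ∀ R', D.IsRenormMap R' → R' = R) ∧
      (D.gluing.surface.teich D.time).IsIso D.cutStack.surface R := by
  refine ⟨D.shift_gluing, ?_⟩
  have : Finite {e // D.lev (D.s e) = 0} := (D.finite_edges 0).to_subtype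
  obtain ⟨R, hR, hiso⟩ := D.pieceIso.exists_isIso D.time fun e => ⟨_, fun _ => rfl⟩
  have hren : D.IsRenormMap R := fun e he p hp =>
    ⟨(D.pieceIso.region_iff ⟨e, he⟩ p hp).1 p.2, hR ⟨e, he⟩ p hp _⟩
  refine ⟨R, ⟨hren, fun R' hR' => ?_⟩, hiso⟩
  -- Every point of the region lies in some piece, which determines the map.
  funext x
  obtain ⟨p, rfl⟩ := Quotient.exists_rep x
  obtain ⟨e, he, hp⟩ := D.exists_piece p.2
  exact (hR' e he p hp).2.trans (hren e he p hp).2.symm
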